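/- Let $c>0$ and let $\lambda\in C^1\bigl((0,\infty),[0,\infty)\bigr)$; $\lambda$ need not be integrable at $0$. A Poisson process with rate function $\mu:(0,\infty)\to[0,\infty)$ is a random set of event times in $(0,\infty)$ such that the numbers $N(s,t]$ of events in disjoint intervals are independent and $N(s,t]$ is Poisson distributed with mean $\int_s^t\mu(r)\,dr$ for $0<s\le t$. Given a velocity process $W=\{W(t)\}_{t\ge0}$ with values in a finite set, we say that $W$ is driven by $N$ with switching probabilities $k(v,w)$ if $W$ changes only at events of $N$; if, for every $t\ge0$, the events after time $t$ are independent of the history up to time $t$ of $W$ and $N$ (in particular $W(0)$ is independent of $N$); and if, for $0\le s\le t$, conditionally on the history up to time $s$, on $W(s)=v$ and on $N(s,t]=1$, one has $W(t)=w$ with probability $k(v,w)$. A telegraph process with parameters $(a,\mu)$, $a>0$, is a process equal to $\int_0^tW(s)\,ds$, $t\ge0$, where $W$ takes the values $\pm a$, $P\{W(0)=a\}=P\{W(0)=-a\}=\tfrac12$, and $W$ is driven by a Poisson process with rate function $\mu$, with $k(v,-v)=1$ (the velocity is reversed at each event). The three-velocity process $\mathcal T$ with velocity $c$ and rate function $\lambda$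 is $\mathcal T(t)=\int_0^tW(s)\,ds$, $t\ge0$, where $W$ takes the values $c,0,-c$, with $P\{W(0)=c\}=P\{W(0)=-c\}=\tfrac14$, $P\{W(0)=0\}=\tfrac12$, and $W$ is driven by a Poisson process with rate function $\lambda$, with $k(\pm c,0)=1$ and $k(0,c)=k(0,-c)=\tfrac12$ (a moving particle stops; a resting one starts in either direction with equal probability). **Theorem.** Let $\{U(t)\}_{t\ge0}$ and $\{V(t)\}_{t\ge0}$ be two independent telegraph processes with parameters $(c/2,\lambda(t)/2)$. Then the process $\{U(t)+V(t)\}_{t\ge0}$ is equal in distribution to the process $\{\mathcal T(t)\}_{t\ge0}$, i.e. they have the same law on $\mathbb R^{[0,\infty)}$ (equivalently, the same finite-dimensional distributions). -/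

import Mathlib

open MeasureTheory ProbabilityTheory
open scoped NNReal ENNReal

/-- The number `N(s, t]` of points of the random set `S` in the interval `(s, t]`. -/
noncomputable def pointCount {Ω : Type*} (S : Ω → Set ℝ≥0) (s t : ℝ≥0) (ω : Ω) : ℕ∞ :=
  (S ω ∩ Set.Ioc s t).encard

/-- The σ-algebra generated by the numbers of points in the intervals contained in `(0, t]`. -/
@[reducible] noncomputable def countsBefore {Ω : Type*} (S : Ω → Set ℝ≥0) (t : ℝ≥0) : MeasurableSpace Ω :=
  ⨆ (s : ℝ≥0) (r : ℝ≥0) (_ : r ≤ t), MeasurableSpace.comap (pointCount S s r) inferInstance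

/-- The σ-algebra generated by the numbers of points in the intervals contained in `(t, ∞)`. -/
@[reducible] noncomputable def countsAfter {Ω : Type*} (S : Ω → Set ℝ≥0) (t : ℝ≥0) : MeasurableSpace Ω :=
  ⨆ (s : ℝ≥0) (r : ℝ≥0) (_ : t ≤ s), MeasurableSpace.comap (pointCount S s r) inferInstance

/-- The random set `S` of event times is (the support of) a non-homogeneous Poisson process on
`(0, ∞)` with rate function `rate`: the numbers of events in disjoint intervals are independent,
and `N(s, t]` is Poisson distributed with mean `∫ r in s..t, rate r` for `0 < s ≤ t`.

The law is only prescribed away from time `0`, since `rate` need not be integrable at `0`. If it is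
integrable there, then letting `s → 0` shows that `N(0, t]` is Poisson with mean
`∫ r in 0..t, rate r`; if it is not, then `N(0, t] = ∞` almost surely. -/
structure IsPoissonProcess {Ω : Type*} [MeasurableSpace Ω] (P : Measure Ω) (rate : ℝ → ℝ)
    (S : Ω → Set ℝ≥0) : Prop where
  measurable_count : ∀ s t, Measurable (pointCount S s t)
  law_count : ∀ s t : ℝ≥0, 0 < s → s ≤ t →
    HasLaw (pointCount S s t)
      ((poissonMeasure (∫ r in (s : ℝ)..t, rate r).toNNReal).map (Nat.cast : ℕ → ℕ∞)) P
  indep_counts : ∀ t, Indep (countsBefore S t) (countsAfter S t) P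

/-- The history up to time `t` of the event times `S` and of the velocity process `W`. -/
@[reducible] noncomputable def history {Ω : Type*} (S : Ω → Set ℝ≥0) (W : ℝ≥0 → Ω → ℝ) (t : ℝ≥0) : MeasurableSpace Ω :=
  countsBefore S t ⊔ ⨆ (s : ℝ≥0) (_ : s ≤ t), MeasurableSpace.comap (W s) inferInstance

/-- `W` is a random velocity with values in `E` and initial law `init`, which changes only at the
event times `S`, and at each of them passes from a value `v` to a new value with law `switch v`:
`P{W(t) = w | N(s, t] = 1, W(s) = v, history up to s} = switch v {w}`.
Events after time `t` are independent of the history up to time `t`; for `t = 0` this says that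
`W 0` is independent of the event times. -/
structure IsSwitchingVelocity {Ω : Type*} [MeasurableSpace Ω] (P : Measure Ω) (E : Set ℝ)
    (init : Measure ℝ) (switch : ℝ → Measure ℝ) (S : Ω → Set ℝ≥0) (W : ℝ≥0 → Ω → ℝ) :
    Prop where
  measurable : ∀ t, Measurable (W t)
  mem_states : ∀ᵐ ω ∂P, ∀ t, W t ω ∈ E
  law_zero : HasLaw (W 0) init P
  eq_of_no_event : ∀ᵐ ω ∂P, ∀ s t, s ≤ t → pointCount S s t ω = 0 → W t ω = W s ω
  indep_history : ∀ t, Indep (history S W t) (countsAfter S t) P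
  switch_at_event : ∀ s t, s ≤ t → ∀ A, MeasurableSet[history S W s] A → ∀ v ∈ E, ∀ w ∈ E,
    P (A ∩ {ω | W s ω = v ∧ pointCount S s t ω = 1 ∧ W t ω = w}) =
      switch v {w} * P (A ∩ {ω | W s ω = v ∧ pointCount S s t ω = 1})

/-- `X` is the motion on the line, started at the origin, with velocity `W`. -/
def IsPositionOf {Ω : Type*} [MeasurableSpace Ω] (P : Measure Ω) (W X : ℝ≥0 → Ω → ℝ) : Prop :=
  ∀ᵐ ω ∂P, ∀ t : ℝ≥0, X t ω = ∫ s in (0 : ℝ)..t, W s.toNNReal ω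

/-- `X` is a (symmetric) telegraph process with velocity `a` and rate function `rate`: the velocity
is initially `a` or `-a` with probability `1/2` each, and is reversed at each event of a Poisson
process with rate function `rate`. -/
def IsTelegraphProcess {Ω : Type*} [MeasurableSpace Ω] (P : Measure Ω) (a : ℝ) (rate : ℝ → ℝ)
    (X : ℝ≥0 → Ω → ℝ) : Prop :=
  ∃ (S : Ω → Set ℝ≥0) (W : ℝ≥0 → Ω → ℝ),
    IsPoissonProcess P rate S ∧
    IsSwitchingVelocity P {a, -a}
      ((2⁻¹ : ℝ≥0∞) • Measure.dirac a + (2⁻¹ : ℝ≥0∞) • Measure.dirac (-a))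
      (fun v => Measure.dirac (-v)) S W ∧
    IsPositionOf P W X

/-- The switching rule of the three-velocity motion: a moving particle stops, and a resting one
starts with velocity `c` or `-c` with probability `1/2` each. -/
noncomputable def threeVelocitySwitch (c : ℝ) (v : ℝ) : Measure ℝ :=
  if v = 0 then (2⁻¹ : ℝ≥0∞) • Measure.dirac c + (2⁻¹ : ℝ≥0∞) • Measure.dirac (-c)
  else Measure.dirac 0

/-- `X` is the three-velocity motion with velocity `c` and rate function `rate`: the velocity is
initially `c`, `0`, `-c` with probabilities `1/4`, `1/2`, `1/4`, and follows the rule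
`threeVelocitySwitch` at each event of a Poisson process with rate function `rate`. -/
def IsThreeVelocityProcess {Ω : Type*} [MeasurableSpace Ω] (P : Measure Ω) (c : ℝ) (rate : ℝ → ℝ)
    (X : ℝ≥0 → Ω → ℝ) : Prop :=
  ∃ (S : Ω → Set ℝ≥0) (W : ℝ≥0 → Ω → ℝ),
    IsPoissonProcess P rate S ∧
    IsSwitchingVelocity P {c, 0, -c}
      ((4⁻¹ : ℝ≥0∞) • Measure.dirac c + (2⁻¹ : ℝ≥0∞) • Measure.dirac 0
        + (4⁻¹ : ℝ≥0∞) • Measure.dirac (-c))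
      (threeVelocitySwitch c) S W ∧
    IsPositionOf P W X

/-! The proof compares velocities through eigenfunctions of the switching kernels. If `f` is an
eigenfunction with eigenvalue κ, then given the history up to `s > 0` the mean of `f (W t)` is `exp
(-(1 - κ) Λ) * f (W s)`, where Λ is the integral of the rate over `(s, t]`
(`IsSwitchingVelocity.setIntegral_eq_exp_mul`). For the three-velocity kernel, `v` and `v ^ 2 - c ^
2 / 2` have eigenvalues 0 and -1, hence decay factors `exp (-Λ)` and `exp (-2Λ)`. For a telegraph
velocity, `v` has eigenvalue -1 at half the rate, hence factor `exp (-Λ)`. If `Y` and `Z` are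
independent with values `± c / 2`, then `(Y + Z) ^ 2 - c ^ 2 / 2 = 2 * Y * Z`, so the sum has the
factors `exp (-Λ)` and `exp (-2Λ)` too.

On `{c, 0, -c}` the functions 1, `v`, `v ^ 2 - c ^ 2 / 2` span all functions. The two decay laws
therefore act as a Markov transition rule, and with the one-time means they determine every
finite-dimensional law (`IsThreeStateMotion.integral_prod_eq`).

Since Λ may be infinite near 0, velocities are compared at positive times only. That both functions
have mean zero at each positive time is obtained by letting the starting time tend to 0: either no
event has yet occurred and the initial mean is still in force, or the process is likely to forget
its state afterwards (`IsSwitchingVelocity.integral_eq_zero`).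

Positions and velocities determine each other almost surely by measurable maps: `rightDeriv` carries
the independence of the positions over to the velocities, and `pathIntegral` carries equality in law
back. -/

/-! ### Step paths: measurable integration and right differentiation -/

section

open Filter Topology

/-- A path which is bounded and, at each positive time, constant on an interval to the right. -/
structure IsStepPath (y : ℝ≥0 → ℝ) : Prop where
  bounded : ∃ C, ∀ t, |y t| ≤ C
  eventually_eq : ∀ s, 0 < s → ∀ᶠ u in 𝓝[>] s, y u = y s

/-- The first multiple of `1 / (n + 1)` strictly to the right of `s`. -/
noncomputable def gridPoint (n : ℕ) (s : ℝ) : Set.Ioi (0 : ℝ≥0) :=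
  ⟨(⌊((n : ℝ) + 1) * s⌋₊ + 1) / (n + 1), by
    rw [Set.mem_Ioi]; positivity⟩

theorem lt_gridPoint (n : ℕ) (s : ℝ≥0) : s < gridPoint n s := by
  rw [← NNReal.coe_lt_coe, gridPoint]
  push_cast
  rw [lt_div_iff₀ (by positivity), mul_comm]
  exact Nat.lt_floor_add_one _

theorem gridPoint_le (n : ℕ) (s : ℝ≥0) : (gridPoint n s : ℝ) ≤ s + 1 / (n + 1) := by
  rw [gridPoint]
  push_cast
  have hn : (0 : ℝ) < n + 1 := by positivity
  rw [div_le_iff₀ hn, add_mul (s : ℝ), div_mul_cancel₀ _ hn.ne', mul_comm (s : ℝ)]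
  gcongr
  exact Nat.floor_le (by positivity)

theorem tendsto_gridPoint (s : ℝ≥0) :
    Tendsto (fun n => (gridPoint n s : ℝ≥0)) atTop (𝓝[>] s) := by
  refine tendsto_nhdsWithin_iff.2 ⟨?_, .of_forall fun n => lt_gridPoint n s⟩
  rw [← NNReal.tendsto_coe]
  refine tendsto_of_tendsto_of_tendsto_of_le_of_le tendsto_const_nhds
    (h := fun n : ℕ => (s : ℝ) + 1 / (n + 1)) ?_
    (fun n => (NNReal.coe_le_coe.2 (lt_gridPoint n s).le)) (fun n => gridPoint_le n s)
  simpa using tendsto_const_nhds.add (tendsto_one_div_add_atTop_nhds_zero_nat (𝕜 := ℝ))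

/-- Evaluation at a variable time is not jointly measurable for the product σ-algebra. The
discretized time takes countably many values, so only coordinate projections are involved. -/
theorem measurable_eval_gridPoint (n : ℕ) :
    Measurable fun p : (Set.Ioi (0 : ℝ≥0) → ℝ) × ℝ => p.1 (gridPoint n p.2) := by
  let q (k : ℕ) : Set.Ioi (0 : ℝ≥0) := ⟨((k : ℝ≥0) + 1) / (n + 1), by rw [Set.mem_Ioi]; positivity⟩
  have h : Measurable fun p : (Set.Ioi (0 : ℝ≥0) → ℝ) × ℕ => p.1 (q p.2) :=
    measurable_from_prod_countable_left fun k => measurable_pi_apply (q k)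
  exact h.comp (measurable_fst.prodMk
    (Nat.measurable_floor.comp (measurable_const.mul measurable_snd)))

theorem measurable_gridPoint (y : Set.Ioi (0 : ℝ≥0) → ℝ) (n : ℕ) :
    Measurable fun s => y (gridPoint n s) :=
  (measurable_eval_gridPoint n).comp measurable_prodMk_left

/-- The integral of a path from `0`, as a limit of integrals of its discretizations. -/
noncomputable def pathIntegral (y : Set.Ioi (0 : ℝ≥0) → ℝ) (t : ℝ≥0) : ℝ :=
  limsup (fun n => ∫ s in (0 : ℝ)..t, y (gridPoint n s)) atTop

theorem measurable_pathIntegral : Measurable pathIntegral := by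
  refine measurable_pi_lambda _ fun t => Measurable.limsup fun n => ?_
  simp only [intervalIntegral.integral_of_le t.coe_nonneg]
  exact (measurable_eval_gridPoint n).stronglyMeasurable.integral_prod_right.measurable

/-- The right derivative of a path. -/
noncomputable def rightDeriv (x : ℝ≥0 → ℝ) (s : Set.Ioi (0 : ℝ≥0)) : ℝ :=
  limsup (fun n : ℕ => ((n : ℝ) + 1) * (x (s + 1 / (n + 1)) - x s)) atTop

theorem measurable_rightDeriv : Measurable rightDeriv :=
  measurable_pi_lambda _ fun _ => Measurable.limsup fun _ =>
    measurable_const.mul ((measurable_pi_apply _).sub (measurable_pi_apply _))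

namespace IsStepPath

variable {y z : ℝ≥0 → ℝ}

theorem add (hy : IsStepPath y) (hz : IsStepPath z) : IsStepPath fun t => y t + z t := by
  obtain ⟨C, hC⟩ := hy.bounded
  obtain ⟨D, hD⟩ := hz.bounded
  refine ⟨⟨C + D, fun t => (abs_add_le _ _).trans (add_le_add (hC t) (hD t))⟩, fun s hs => ?_⟩
  filter_upwards [hy.eventually_eq s hs, hz.eventually_eq s hs] with u h1 h2
  rw [h1, h2]

theorem tendsto_gridPoint (hy : IsStepPath y) {s : ℝ} (hs : 0 < s) :
    Tendsto (fun n => y (gridPoint n s)) atTop (𝓝 (y s.toNNReal)) := by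
  have h := (_root_.tendsto_gridPoint s.toNNReal).eventually
    (hy.eventually_eq s.toNNReal (Real.toNNReal_pos.2 hs))
  rw [Real.coe_toNNReal _ hs.le] at h
  exact tendsto_const_nhds.congr' (h.mono fun n hn => hn.symm)

theorem intervalIntegrable (hy : IsStepPath y) {s t : ℝ} (hs : 0 ≤ s) (ht : 0 ≤ t) :
    IntervalIntegrable (fun r : ℝ => y r.toNNReal) volume s t := by
  obtain ⟨C, hC⟩ := hy.bounded
  have hm : AEStronglyMeasurable (fun r : ℝ => y r.toNNReal) (volume.restrict (Set.uIoc s t)) := by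
    refine aestronglyMeasurable_of_tendsto_ae atTop (f := fun n r => y (gridPoint n r))
      (fun n => (measurable_gridPoint (fun s => y s) n).aestronglyMeasurable) ?_
    refine (ae_restrict_iff' measurableSet_uIoc).2 (.of_forall fun r hr => ?_)
    exact hy.tendsto_gridPoint ((le_min hs ht).trans_lt hr.1)
  have : IsFiniteMeasure (volume.restrict (Set.uIoc s t)) := by
    unfold Set.uIoc
    infer_instance
  rw [intervalIntegrable_iff]
  exact Integrable.of_bound (C := C) hm (.of_forall fun r => hC _)

/-- Grid points approach each time strictly from the right, where the path is locally constant;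
boundedness then allows dominated convergence. The `limsup` makes the functional measurable on all
paths, and here it is a limit. -/
theorem pathIntegral_eq (hy : IsStepPath y) (t : ℝ≥0) :
    pathIntegral (fun s => y s) t = ∫ s in (0 : ℝ)..t, y s.toNNReal := by
  obtain ⟨C, hC⟩ := hy.bounded
  refine Tendsto.limsup_eq ?_
  refine intervalIntegral.tendsto_integral_filter_of_dominated_convergence (fun _ => C)
    (.of_forall fun n => (measurable_gridPoint (fun s => y s) n).aestronglyMeasurable)
    (.of_forall fun n => .of_forall fun r _ => hC _) intervalIntegrable_const
    (.of_forall fun r hr => ?_)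
  rw [Set.uIoc_of_le t.coe_nonneg] at hr
  exact hy.tendsto_gridPoint hr.1

theorem rightDeriv_eq (hy : IsStepPath y) {x : ℝ≥0 → ℝ}
    (hx : ∀ t : ℝ≥0, x t = ∫ s in (0 : ℝ)..t, y s.toNNReal) (s : Set.Ioi (0 : ℝ≥0)) :
    rightDeriv x s = y s := by
  refine Tendsto.limsup_eq (tendsto_const_nhds.congr' ?_)
  obtain ⟨u, hu, hyu⟩ := mem_nhdsGT_iff_exists_Ioo_subset.1 (hy.eventually_eq s s.2)
  have hlim : Tendsto (fun n : ℕ => (s : ℝ) + 1 / (n + 1)) atTop (𝓝 (s + 0)) :=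
    tendsto_const_nhds.add (tendsto_one_div_add_atTop_nhds_zero_nat (𝕜 := ℝ))
  rw [add_zero] at hlim
  -- As soon as `1 / (n + 1)` is shorter than the interval of constancy, the difference quotient
  -- equals `y s` exactly.
  filter_upwards [hlim.eventually_lt_const (NNReal.coe_lt_coe.2 hu)] with n hn
  have hpos : (0 : ℝ) < 1 / (n + 1) := by positivity
  rw [hx, hx, intervalIntegral.integral_interval_sub_left
    (hy.intervalIntegrable le_rfl (by positivity)) (hy.intervalIntegrable le_rfl (by positivity))]
  have hcongr : ∫ r in ((s : ℝ≥0) : ℝ)..((s + 1 / (n + 1) : ℝ≥0) : ℝ), y r.toNNReal =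
      ∫ r in ((s : ℝ≥0) : ℝ)..((s + 1 / (n + 1) : ℝ≥0) : ℝ), y s := by
    refine intervalIntegral.integral_congr_ae (.of_forall fun r hr => ?_)
    push_cast at hr
    rw [Set.uIoc_of_le (by linarith)] at hr
    refine hyu ⟨?_, ?_⟩
    · exact Real.lt_toNNReal_iff_coe_lt.2 hr.1
    · exact (Real.toNNReal_lt_iff_lt_coe (le_trans (by positivity) hr.1.le)).2 (hr.2.trans_lt hn)
  rw [hcongr, intervalIntegral.integral_const]
  push_cast
  rw [add_sub_cancel_left, smul_eq_mul]
  field_simp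

end IsStepPath

end

/-! ### Poisson counts and elementary estimates -/

section

open Filter Topology

variable {Ω : Type*} {rate : ℝ → ℝ} {S : Ω → Set ℝ≥0}

theorem rate_integral_nonneg (hrate : ∀ t, 0 < t → 0 ≤ rate t) {s t : ℝ} (hs : 0 < s)
    (hst : s ≤ t) : 0 ≤ ∫ r in s..t, rate r :=
  intervalIntegral.integral_nonneg hst fun r hr => hrate r (hs.trans_le hr.1)

theorem rate_intervalIntegrable (hcont : ContinuousOn rate (Set.Ioi 0)) {s t : ℝ} (hs : 0 < s)
    (ht : 0 < t) : IntervalIntegrable rate volume s t :=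
  (hcont.mono fun _ hr => (lt_min hs ht).trans_le hr.1).intervalIntegrable

theorem measurableSet_count_eq_countsBefore {s t u : ℝ≥0} (htu : t ≤ u) (n : ℕ∞) :
    MeasurableSet[countsBefore S u] {ω | pointCount S s t ω = n} := by
  have h : MeasurableSpace.comap (pointCount S s t) inferInstance ≤ countsBefore S u :=
    le_iSup_of_le s (le_iSup₂_of_le t htu le_rfl)
  exact h _ ⟨{n}, MeasurableSet.singleton _, rfl⟩

theorem measurableSet_count_eq_countsAfter {s t u : ℝ≥0} (hus : u ≤ s) (n : ℕ∞) :
    MeasurableSet[countsAfter S u] {ω | pointCount S s t ω = n} := by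
  have h : MeasurableSpace.comap (pointCount S s t) inferInstance ≤ countsAfter S u :=
    le_iSup_of_le s (le_iSup₂_of_le t hus le_rfl)
  exact h _ ⟨{n}, MeasurableSet.singleton _, rfl⟩

theorem pointCount_eq_zero_iff {s t : ℝ≥0} {ω : Ω} :
    pointCount S s t ω = 0 ↔ ∀ r ∈ S ω, s < r → t < r := by
  rw [pointCount, Set.encard_eq_zero, Set.eq_empty_iff_forall_notMem]
  simp only [Set.mem_inter_iff, Set.mem_Ioc, not_and, not_le]

variable [MeasurableSpace Ω] {P : Measure Ω}

namespace IsPoissonProcess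

theorem measurableSet_count_eq (hS : IsPoissonProcess P rate S) (s t : ℝ≥0) (n : ℕ∞) :
    MeasurableSet {ω | pointCount S s t ω = n} :=
  hS.measurable_count s t (MeasurableSet.singleton _)

theorem measureReal_count_eq (hS : IsPoissonProcess P rate S) (hrate : ∀ t, 0 < t → 0 ≤ rate t)
    {s t : ℝ≥0} (hs : 0 < s) (hst : s ≤ t) (n : ℕ) :
    P.real {ω | pointCount S s t ω = n} =
      Real.exp (-∫ r in (s : ℝ)..t, rate r) * (∫ r in (s : ℝ)..t, rate r) ^ n / n.factorial := by
  rw [(hS.law_count s t hs hst).measureReal_eq (p := fun x => x = (n : ℕ∞))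
    (MeasurableSet.singleton _), Set.ofPred_eq_eq_singleton,
    map_measureReal_apply .of_discrete (MeasurableSet.singleton _)]
  have : (Nat.cast : ℕ → ℕ∞) ⁻¹' {(n : ℕ∞)} = {n} := by ext; simp
  rw [this, poissonMeasure_real_singleton,
    Real.coe_toNNReal _ (rate_integral_nonneg hrate (NNReal.coe_pos.2 hs) (NNReal.coe_le_coe.2 hst))]

theorem ae_count_ne_top (hS : IsPoissonProcess P rate S) {s t : ℝ≥0} (hs : 0 < s) (hst : s ≤ t) :
    ∀ᵐ ω ∂P, pointCount S s t ω ≠ ⊤ := by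
  rw [ae_iff]
  simp only [not_not]
  rw [(hS.law_count s t hs hst).measure_eq (p := fun x => x = ⊤) (MeasurableSet.singleton _),
    Set.ofPred_eq_eq_singleton, Measure.map_apply .of_discrete (MeasurableSet.singleton _)]
  have : (Nat.cast : ℕ → ℕ∞) ⁻¹' {⊤} = ∅ := by ext; simp
  rw [this, measure_empty]

/-- Almost surely, each interval of a countable family exhausting `(0, ∞)` contains finitely many
events, so there is a gap to the right of each positive time. This may fail at 0, where events can
accumulate. -/
theorem ae_eventually_count_eq_zero (hS : IsPoissonProcess P rate S) :
    ∀ᵐ ω ∂P, ∀ s : ℝ≥0, 0 < s → ∀ᶠ u in 𝓝[>] s, pointCount S s u ω = 0 := by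
  have h : ∀ᵐ ω ∂P, ∀ n : ℕ, pointCount S (1 / (n + 1)) (n + 1) ω ≠ ⊤ := by
    refine ae_all_iff.2 fun n => hS.ae_count_ne_top (by positivity) ?_
    rw [div_le_iff₀ (by positivity)]
    exact one_le_mul (by simp) (by simp)
  filter_upwards [h] with ω hω s hs
  obtain ⟨n, hn⟩ := exists_nat_one_div_lt hs
  obtain ⟨k, hk⟩ := exists_nat_gt s
  have h1 : 1 / ((max n k : ℕ) + 1 : ℝ≥0) ≤ s := by
    refine le_trans ?_ hn.le
    gcongr
    exact le_max_left _ _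
  have h2 : s < (max n k : ℕ) + 1 := by
    refine hk.trans ?_
    refine lt_of_le_of_lt (Nat.cast_le.2 (le_max_right n k)) (lt_add_one _)
  have hfin := Set.encard_ne_top_iff.1 (hω (max n k))
  have h3 : ∀ᶠ u in 𝓝 s, ∀ r ∈ S ω ∩ Set.Ioc (1 / ((max n k : ℕ) + 1 : ℝ≥0)) ((max n k : ℕ) + 1),
      s < r → u < r := by
    refine (eventually_all_finite hfin).2 fun r _ => ?_
    by_cases hr : s < r
    · filter_upwards [eventually_lt_nhds hr] with u hu _ using hu
    · exact .of_forall fun u h => (hr h).elim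
  filter_upwards [nhdsWithin_le_nhds h3, nhdsWithin_le_nhds (eventually_lt_nhds h2)] with u hu hu2
  refine pointCount_eq_zero_iff.2 fun r hr hsr => ?_
  by_cases hr2 : r ≤ (max n k : ℕ) + 1
  · exact hu r ⟨hr, h1.trans_lt hsr, hr2⟩ hsr
  · exact hu2.trans (not_le.1 hr2)

end IsPoissonProcess

/-- A function with quadratically small increments is constant. -/
theorem eq_of_abs_sub_le_sq {f : ℝ → ℝ} {a b D : ℝ} (hab : a ≤ b)
    (h : ∀ x y, a ≤ x → x ≤ y → y ≤ b → |f y - f x| ≤ D * (y - x) ^ 2) : f b = f a := by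
  have hderiv : ∀ x ∈ Set.Icc a b, HasDerivWithinAt f 0 (Set.Icc a b) x := by
    intro x hx
    rw [hasDerivWithinAt_iff_isLittleO]
    simp only [smul_zero, sub_zero]
    have h1 : (fun y => f y - f x) =O[𝓝[Set.Icc a b] x] fun y => (y - x) ^ 2 := by
      refine Asymptotics.IsBigO.of_bound D ?_
      filter_upwards [self_mem_nhdsWithin] with y hy
      rw [Real.norm_eq_abs, Real.norm_eq_abs, abs_of_nonneg (sq_nonneg (y - x))]
      rcases le_total x y with hxy | hxy
      · exact h x y hx.1 hxy hy.2
      · rw [abs_sub_comm, ← neg_sub x y, neg_sq]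
        exact h y x hy.1 hxy hx.2
    refine h1.trans_isLittleO ?_
    have h2 : (fun y => (y - x) ^ 2) =o[𝓝 x] fun y => y - x := by
      simpa using (Asymptotics.isLittleO_pow_sub_sub x (m := 2) one_lt_two)
    exact h2.mono nhdsWithin_le_nhds
  refine constant_of_derivWithin_zero (fun x hx => (hderiv x hx).differentiableWithinAt)
    (fun x hx => ?_) b ⟨hab, le_rfl⟩
  rcases hab.eq_or_lt with rfl | hlt
  · simp at hx
  · exact (hderiv x ⟨hx.1, hx.2.le⟩).derivWithin (uniqueDiffOn_Icc hlt x ⟨hx.1, hx.2.le⟩)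

theorem abs_one_add_sub_exp_le {x : ℝ} (hx : x ≤ 0) : |1 + x - Real.exp x| ≤ x ^ 2 := by
  rcases le_or_gt (-1) x with h | h
  · rw [abs_sub_comm, ← sub_sub]
    exact Real.abs_exp_sub_one_sub_id_le (abs_le.2 ⟨h, hx.trans zero_le_one⟩)
  -- Below -1 the Taylor bound is replaced by `1 + x ≤ exp x ≤ 1`, which bounds the difference by
  -- `-x ≤ x ^ 2`.
  · have h1 := Real.add_one_le_exp x
    have h2 := Real.exp_le_one_iff.2 hx
    rw [abs_le]
    constructor <;> nlinarith

end

/-! ### Switching velocities: exponential decay of eigenfunctions -/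

section

open Filter Topology

variable {Ω : Type*}

variable {E : Finset ℝ} {init : Measure ℝ} {switch : ℝ → Measure ℝ} {S : Ω → Set ℝ≥0}
  {W : ℝ≥0 → Ω → ℝ} {rate : ℝ → ℝ}

theorem measurable_history {s t : ℝ≥0} (hst : s ≤ t) : Measurable[history S W t] (W s) := by
  refine Measurable.of_comap_le (le_sup_of_le_right ?_)
  exact le_iSup₂_of_le s hst le_rfl

theorem history_mono {s t : ℝ≥0} (hst : s ≤ t) : history S W s ≤ history S W t := by
  refine sup_le_sup ?_ ?_
  · exact iSup_mono fun u => iSup_mono fun r => iSup_mono' fun h => ⟨h.trans hst, le_rfl⟩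
  · exact iSup_mono fun r => iSup_mono' fun h => ⟨h.trans hst, le_rfl⟩

variable [mΩ : MeasurableSpace Ω] {P : Measure Ω}

theorem history_le (hS : IsPoissonProcess P rate S) (hW : ∀ t, Measurable (W t)) (t : ℝ≥0) :
    history S W t ≤ mΩ :=
  sup_le (iSup_le fun s => iSup₂_le fun r _ => (hS.measurable_count s r).comap_le)
    (iSup₂_le fun s _ => (hW s).comap_le)

namespace IsSwitchingVelocity

theorem ae_isStepPath (hW : IsSwitchingVelocity P E init switch S W)
    (hS : IsPoissonProcess P rate S) : ∀ᵐ ω ∂P, IsStepPath fun t => W t ω := by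
  filter_upwards [hW.mem_states, hW.eq_of_no_event, hS.ae_eventually_count_eq_zero] with ω h1 h2 h3
  refine ⟨⟨∑ v ∈ E, |v|, fun t =>
    Finset.single_le_sum (f := fun v => |v|) (fun v _ => abs_nonneg v) (h1 t)⟩, fun s hs => ?_⟩
  filter_upwards [h3 s hs, self_mem_nhdsWithin] with u hu hsu
  exact h2 s u (le_of_lt hsu) hu

theorem ae_mem (hW : IsSwitchingVelocity P E init switch S W) (t : ℝ≥0) :
    ∀ᵐ ω ∂P, W t ω ∈ E := hW.mem_states.mono fun _ h => h t

theorem measureReal_inter_count (hW : IsSwitchingVelocity P E init switch S W) {s t u : ℝ≥0}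
    (hsu : s ≤ u) (n : ℕ∞) {A : Set Ω} (hA : MeasurableSet[history S W s] A) :
    P.real (A ∩ {ω | pointCount S u t ω = n}) = P.real A * P.real {ω | pointCount S u t ω = n} := by
  simp only [measureReal_def, ← ENNReal.toReal_mul]
  rw [(Indep_iff _ _ _).1 (hW.indep_history s) A _ hA (measurableSet_count_eq_countsAfter hsu n)]

end IsSwitchingVelocity

variable {Y : Ω → ℝ}

/-- Finiteness of the state space turns all integrals into finite sums, for an arbitrary `f`. -/
theorem comp_ae_eq_sum_of_mem (hmem : ∀ᵐ ω ∂P, Y ω ∈ E) (f : ℝ → ℝ) :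
    (fun ω => f (Y ω)) =ᵐ[P] fun ω => ∑ v ∈ E, (Y ⁻¹' {v}).indicator (fun _ => f v) ω := by
  filter_upwards [hmem] with ω hω
  rw [Finset.sum_eq_single (Y ω)]
  · simp
  · intro v _ hv
    exact Set.indicator_of_notMem (s := Y ⁻¹' {v}) (f := fun _ => f v)
      (fun h => hv (Set.mem_singleton_iff.1 h).symm)
  · exact fun h => (h hω).elim

variable [IsProbabilityMeasure P]

theorem integrable_comp_of_mem (hY : Measurable Y) (hmem : ∀ᵐ ω ∂P, Y ω ∈ E) (f : ℝ → ℝ) :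
    Integrable (fun ω => f (Y ω)) P := by
  refine (integrable_congr (comp_ae_eq_sum_of_mem hmem f)).2 (integrable_finsetSum _ fun v _ => ?_)
  exact (integrable_const _).indicator (hY (MeasurableSet.singleton v))

theorem setIntegral_comp_of_mem (hY : Measurable Y) (hmem : ∀ᵐ ω ∂P, Y ω ∈ E) (f : ℝ → ℝ)
    (B : Set Ω) :
    ∫ ω in B, f (Y ω) ∂P = ∑ v ∈ E, f v * P.real (B ∩ Y ⁻¹' {v}) := by
  rw [integral_congr_ae (ae_restrict_of_ae (comp_ae_eq_sum_of_mem hmem f)), integral_finsetSum]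
  · refine Finset.sum_congr rfl fun v _ => ?_
    rw [integral_indicator_const _ (hY (MeasurableSet.singleton v)), smul_eq_mul, mul_comm,
      measureReal_restrict_apply (hY (MeasurableSet.singleton v)), Set.inter_comm]
  · exact fun v _ => ((integrable_const _).indicator (hY (MeasurableSet.singleton v))).integrableOn

theorem measureReal_eq_sum_of_mem (hY : Measurable Y) (hmem : ∀ᵐ ω ∂P, Y ω ∈ E) (B : Set Ω) :
    P.real B = ∑ v ∈ E, P.real (B ∩ Y ⁻¹' {v}) := by
  simpa using setIntegral_comp_of_mem hY hmem (fun _ => 1) B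

theorem abs_setIntegral_comp_le (hmem : ∀ᵐ ω ∂P, Y ω ∈ E) {f : ℝ → ℝ} {C : ℝ}
    (hC : ∀ v ∈ E, |f v| ≤ C) (B : Set Ω) : |∫ ω in B, f (Y ω) ∂P| ≤ C * P.real B := by
  refine norm_setIntegral_le_of_norm_le_const_ae (f := fun ω => f (Y ω)) (measure_lt_top P B) ?_
  exact ae_restrict_of_ae (hmem.mono fun ω hω => hC _ hω)

namespace IsSwitchingVelocity

theorem setIntegral_no_event (hW : IsSwitchingVelocity P E init switch S W)
    (hS : IsPoissonProcess P rate S) {s t : ℝ≥0} (hst : s ≤ t) (f : ℝ → ℝ) {A : Set Ω}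
    (hA : MeasurableSet[history S W s] A) :
    ∫ ω in A ∩ {ω | pointCount S s t ω = 0}, f (W t ω) ∂P =
      P.real {ω | pointCount S s t ω = 0} * ∫ ω in A, f (W s ω) ∂P := by
  have hmA := history_le hS hW.measurable s A hA
  have h1 : ∫ ω in A ∩ {ω | pointCount S s t ω = 0}, f (W t ω) ∂P =
      ∫ ω in A ∩ {ω | pointCount S s t ω = 0}, f (W s ω) ∂P := by
    refine setIntegral_congr_ae (hmA.inter (hS.measurableSet_count_eq s t 0)) ?_
    filter_upwards [hW.eq_of_no_event] with ω hω h
    rw [hω s t hst h.2]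
  rw [h1, setIntegral_comp_of_mem (hW.measurable s) (hW.ae_mem s),
    setIntegral_comp_of_mem (hW.measurable s) (hW.ae_mem s), Finset.mul_sum]
  refine Finset.sum_congr rfl fun v _ => ?_
  rw [Set.inter_right_comm, hW.measureReal_inter_count le_rfl 0
    (hA.inter (measurable_history le_rfl (MeasurableSet.singleton v)))]
  ring

/-- The switching rule averages `f` over the new state, producing κ; the count after `s` is
independent of the history, producing the probability factor. -/
theorem setIntegral_one_event (hW : IsSwitchingVelocity P E init switch S W) {s t : ℝ≥0}
    (hst : s ≤ t) {f : ℝ → ℝ} {κ : ℝ}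
    (hf : ∀ v ∈ E, ∑ w ∈ E, (switch v {w}).toReal * f w = κ * f v) {A : Set Ω}
    (hA : MeasurableSet[history S W s] A) :
    ∫ ω in A ∩ {ω | pointCount S s t ω = 1}, f (W t ω) ∂P =
      κ * P.real {ω | pointCount S s t ω = 1} * ∫ ω in A, f (W s ω) ∂P := by
  have h1 : ∀ v ∈ E, ∀ w ∈ E,
      P.real (A ∩ {ω | pointCount S s t ω = 1} ∩ W t ⁻¹' {w} ∩ W s ⁻¹' {v}) =
        (switch v {w}).toReal *
          (P.real (A ∩ W s ⁻¹' {v}) * P.real {ω | pointCount S s t ω = 1}) := by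
    intro v hv w hw
    rw [← hW.measureReal_inter_count le_rfl 1
      (hA.inter (measurable_history le_rfl (MeasurableSet.singleton v)))]
    have h := congrArg ENNReal.toReal (hW.switch_at_event s t hst A hA v hv w hw)
    rw [ENNReal.toReal_mul] at h
    convert h using 2
    · congr 1
      ext ω
      simp
      tauto
    · congr 1
      ext ω
      simp
      tauto
  rw [setIntegral_comp_of_mem (hW.measurable t) (hW.ae_mem t),
    setIntegral_comp_of_mem (hW.measurable s) (hW.ae_mem s)]
  simp_rw [measureReal_eq_sum_of_mem (hW.measurable s) (hW.ae_mem s)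
    (A ∩ {ω | pointCount S s t ω = 1} ∩ _), Finset.mul_sum]
  rw [Finset.sum_comm]
  refine Finset.sum_congr rfl fun v hv => ?_
  calc _ = ∑ w ∈ E, ((switch v {w}).toReal * f w) *
        (P.real (A ∩ W s ⁻¹' {v}) * P.real {ω | pointCount S s t ω = 1}) :=
        Finset.sum_congr rfl fun w hw => by rw [h1 v hv w hw]; ring
    _ = _ := by rw [← Finset.sum_mul, hf v hv]; ring

/-- Split by the number of events in `(s, t]`: none contributes `exp (-m)`, one contributes `κ * m *
exp (-m)`, and two or more have probability at most `m ^ 2`. -/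
theorem abs_setIntegral_sub_le (hW : IsSwitchingVelocity P E init switch S W)
    (hS : IsPoissonProcess P rate S) (hrate : ∀ t, 0 < t → 0 ≤ rate t)
    {s t : ℝ≥0} (hs : 0 < s) (hst : s ≤ t) {f : ℝ → ℝ} {κ C : ℝ}
    (hf : ∀ v ∈ E, ∑ w ∈ E, (switch v {w}).toReal * f w = κ * f v) (hC : ∀ v ∈ E, |f v| ≤ C)
    {A : Set Ω} (hA : MeasurableSet[history S W s] A) {m : ℝ}
    (hm : m = ∫ r in (s : ℝ)..t, rate r) :
    |∫ ω in A, f (W t ω) ∂P - Real.exp (-m) * (1 + κ * m) * ∫ ω in A, f (W s ω) ∂P| ≤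
      C * m ^ 2 := by
  have hmA := history_le hS hW.measurable s A hA
  have hint := integrable_comp_of_mem (hW.measurable t) (hW.ae_mem t) f
  have h0 := hS.measureReal_count_eq hrate hs hst 0
  have h1 := hS.measureReal_count_eq hrate hs hst 1
  rw [← hm] at h0 h1
  simp only [Nat.cast_zero, pow_zero, mul_one, Nat.factorial_zero, Nat.cast_one, div_one,
    pow_one, Nat.factorial_one] at h0 h1
  have hm0 := hS.measurableSet_count_eq s t 0
  have hm1 := hS.measurableSet_count_eq s t 1
  set N0 := {ω | pointCount S s t ω = 0} with hN0
  set N1 := {ω | pointCount S s t ω = 1} with hN1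
  have hdisj : Disjoint N0 N1 := by
    rw [Set.disjoint_left]
    intro ω ha hb
    exact zero_ne_one (ha.symm.trans hb)
  have e0 := integral_inter_add_sdiff (s := A) hm0 hint.integrableOn
  have e1 := integral_inter_add_sdiff (s := A \ N0) hm1 hint.integrableOn
  have hA1 : (A \ N0) ∩ N1 = A ∩ N1 := by
    ext ω
    have := fun h : ω ∈ N0 => Set.disjoint_left.1 hdisj h
    simp only [Set.mem_inter_iff, Set.mem_sdiff]
    tauto
  rw [hA1, hW.setIntegral_one_event hst hf hA] at e1
  rw [hW.setIntegral_no_event hS hst f hA, ← e1] at e0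
  have hrest : ∫ ω in A, f (W t ω) ∂P - Real.exp (-m) * (1 + κ * m) * ∫ ω in A, f (W s ω) ∂P =
      ∫ ω in (A \ N0) \ N1, f (W t ω) ∂P := by
    rw [← e0, h0, h1]
    ring
  rw [hrest]
  refine (abs_setIntegral_comp_le (hW.ae_mem t) hC _).trans ?_
  have hE : E.Nonempty := by
    obtain ⟨ω, hω⟩ := (hW.ae_mem t).exists
    exact ⟨_, hω⟩
  have hC0 : 0 ≤ C := (abs_nonneg _).trans (hC _ hE.choose_spec)
  refine mul_le_mul_of_nonneg_left ?_ hC0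
  have hsub : P.real ((A \ N0) \ N1) ≤ P.real (N0 ∪ N1)ᶜ :=
    measureReal_mono fun ω hω => fun h => h.elim hω.1.2 hω.2
  refine hsub.trans ?_
  rw [probReal_compl_eq_one_sub (hm0.union hm1), measureReal_union hdisj hm1, h0, h1]
  have hm_nonneg : 0 ≤ m := hm ▸ rate_integral_nonneg hrate hs hst
  -- `(1 + m) * exp (-m) ≥ (1 + m) * (1 - m) = 1 - m ^ 2`.
  nlinarith [Real.add_one_le_exp (-m)]

/-- Eigenfunctions of the switching kernel decay exponentially along the motion. -/
theorem setIntegral_eq_exp_mul (hW : IsSwitchingVelocity P E init switch S W)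
    (hS : IsPoissonProcess P rate S) (hrate : ∀ t, 0 < t → 0 ≤ rate t)
    (hcont : ContinuousOn rate (Set.Ioi 0)) {s t : ℝ≥0} (hs : 0 < s) (hst : s ≤ t) {f : ℝ → ℝ}
    {κ : ℝ} (hf : ∀ v ∈ E, ∑ w ∈ E, (switch v {w}).toReal * f w = κ * f v)
    (hκ : -1 ≤ κ) (hκ' : κ ≤ 0) {A : Set Ω} (hA : MeasurableSet[history S W s] A) :
    ∫ ω in A, f (W t ω) ∂P =
      Real.exp (-((1 - κ) * ∫ r in (s : ℝ)..t, rate r)) * ∫ ω in A, f (W s ω) ∂P := by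
  have hs' : (0 : ℝ) < s := hs
  have hst' : (s : ℝ) ≤ t := hst
  obtain ⟨M, hM⟩ := isCompact_Icc.exists_bound_of_continuousOn
    (hcont.mono (fun r hr => hs'.trans_le hr.1) : ContinuousOn rate (Set.Icc s t))
  let C := ∑ v ∈ E, |f v|
  have hC : ∀ v ∈ E, |f v| ≤ C := fun v hv =>
    Finset.single_le_sum (f := fun v => |f v|) (fun v _ => abs_nonneg _) hv
  have hC0 : 0 ≤ C := Finset.sum_nonneg fun v _ => abs_nonneg _
  let L : ℝ → ℝ := fun x => ∫ r in (s : ℝ)..x, rate r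
  let φ : ℝ → ℝ := fun x => ∫ ω in A, f (W x.toNNReal ω) ∂P
  have hφ : ∀ x, |φ x| ≤ C := fun x =>
    (abs_setIntegral_comp_le (hW.ae_mem _) hC A).trans
      (mul_le_of_le_one_right hC0 measureReal_le_one)
  have hmono : ∀ x y, (s : ℝ) ≤ x → x ≤ y → L y = L x + ∫ r in x..y, rate r := fun x y hx hxy =>
    (intervalIntegral.integral_add_adjacent_intervals
      (rate_intervalIntegrable hcont hs' (hs'.trans_le hx))
      (rate_intervalIntegrable hcont (hs'.trans_le hx) (hs'.trans_le (hx.trans hxy)))).symm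
  -- The integrating factor `exp ((1 - κ) * L x)` should make the product constant. No
  -- differentiability of `φ` is known in advance; the quadratic bound on increments replaces it.
  have key := eq_of_abs_sub_le_sq (f := fun x => Real.exp ((1 - κ) * L x) * φ x)
    (D := Real.exp ((1 - κ) * L t) * (2 * C * M ^ 2)) hst' ?_
  · have hLs : L s = 0 := intervalIntegral.integral_same
    simp only [hLs, mul_zero, Real.exp_zero, one_mul] at key
    simp only [φ, Real.toNNReal_coe] at key
    rw [← key, ← mul_assoc, ← Real.exp_add, neg_add_cancel, Real.exp_zero, one_mul]
  intro x y hx hxy hy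
  have hx0 := hs'.trans_le hx
  have hy0 := hx0.trans_le hxy
  set m := ∫ r in x..y, rate r with hm
  have hm0 : 0 ≤ m := rate_integral_nonneg hrate hx0 hxy
  have hmM : m ≤ M * (y - x) := by
    have := intervalIntegral.norm_integral_le_of_norm_le_const (f := rate) (a := x) (b := y) (C := M)
      fun r hr => by
        rw [Set.uIoc_of_le hxy] at hr
        exact hM r ⟨hx.trans hr.1.le, hr.2.trans hy⟩
    rw [abs_of_nonneg (sub_nonneg.2 hxy)] at this
    exact (le_abs_self _).trans this
  have hLt : L y ≤ L t := by
    rw [hmono y t (hx.trans hxy) hy]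
    linarith [rate_integral_nonneg hrate hy0 hy]
  have h1 : |φ y - Real.exp (-m) * (1 + κ * m) * φ x| ≤ C * m ^ 2 := by
    refine hW.abs_setIntegral_sub_le hS hrate (Real.toNNReal_pos.2 hx0)
      (Real.toNNReal_le_toNNReal hxy) hf hC
      (history_mono (NNReal.coe_le_coe.1 ?_) A hA) ?_
    · rwa [Real.coe_toNNReal _ hx0.le]
    · rw [Real.coe_toNNReal _ hx0.le, Real.coe_toNNReal _ hy0.le]
  -- Replacing `1 + κ * m` by `exp (κ * m)` also costs only order `m ^ 2`, because `|κ| ≤ 1`.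
  have h2 : |Real.exp (-m) * (1 + κ * m - Real.exp (κ * m)) * φ x| ≤ C * m ^ 2 := by
    rw [abs_mul, abs_mul, Real.abs_exp]
    have ha := Real.exp_le_one_iff.2 (neg_nonpos.2 hm0)
    have hb := abs_one_add_sub_exp_le (mul_nonpos_of_nonpos_of_nonneg hκ' hm0)
    have hc : (κ * m) ^ 2 ≤ m ^ 2 := by
      rw [mul_pow]
      exact mul_le_of_le_one_left (sq_nonneg m) (by nlinarith)
    calc _ ≤ 1 * m ^ 2 * C :=
          mul_le_mul (mul_le_mul ha (hb.trans hc) (abs_nonneg _) zero_le_one) (hφ x)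
            (abs_nonneg _) (by positivity)
      _ = _ := by ring
  have h3 : |φ y - Real.exp (-((1 - κ) * m)) * φ x| ≤ 2 * C * m ^ 2 := by
    have he : Real.exp (-((1 - κ) * m)) = Real.exp (-m) * Real.exp (κ * m) := by
      rw [← Real.exp_add]
      congr 1
      ring
    have : φ y - Real.exp (-((1 - κ) * m)) * φ x =
        (φ y - Real.exp (-m) * (1 + κ * m) * φ x) +
          Real.exp (-m) * (1 + κ * m - Real.exp (κ * m)) * φ x := by
      rw [he]
      ring
    rw [this]
    exact (abs_add_le _ _).trans (by linarith)
  have h4 : Real.exp ((1 - κ) * L y) * φ y - Real.exp ((1 - κ) * L x) * φ x =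
      Real.exp ((1 - κ) * L y) * (φ y - Real.exp (-((1 - κ) * m)) * φ x) := by
    rw [mul_sub, ← mul_assoc, ← Real.exp_add, hmono x y hx hxy]
    congr 3
    ring
  rw [h4, abs_mul, Real.abs_exp, mul_assoc]
  refine mul_le_mul (Real.exp_le_exp.2 (mul_le_mul_of_nonneg_left hLt (by linarith)))
    (h3.trans ?_) (abs_nonneg _) (Real.exp_pos _).le
  calc 2 * C * m ^ 2 ≤ 2 * C * (M * (y - x)) ^ 2 := by gcongr
    _ = _ := by ring

/-- Without an event in `(0, s]` the state is still the initial one, whose mean vanishes; so the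
mean at `s` is at most `2 * C` times the probability of an event there. The later decay factor is at
most `exp (-Λ)`, the probability of no event in `(s, t]`, because `κ ≤ 0`. By independence the two
probabilities multiply. -/
theorem abs_integral_le (hW : IsSwitchingVelocity P E init switch S W)
    (hS : IsPoissonProcess P rate S) (hrate : ∀ t, 0 < t → 0 ≤ rate t)
    (hcont : ContinuousOn rate (Set.Ioi 0)) {s t : ℝ≥0} (hs : 0 < s) (hst : s ≤ t) {f : ℝ → ℝ}
    {κ C : ℝ} (hf : ∀ v ∈ E, ∑ w ∈ E, (switch v {w}).toReal * f w = κ * f v)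
    (hκ : -1 ≤ κ) (hκ' : κ ≤ 0) (hC : ∀ v ∈ E, |f v| ≤ C) (hinit : ∫ ω, f (W 0 ω) ∂P = 0) :
    |∫ ω, f (W t ω) ∂P| ≤
      2 * C * P.real ({ω | pointCount S 0 s ω = 0}ᶜ ∩ {ω | pointCount S s t ω = 0}) := by
  have hd := hW.setIntegral_eq_exp_mul hS hrate hcont hs hst hf hκ hκ' MeasurableSet.univ
  have h0 := hS.measureReal_count_eq hrate hs hst 0
  simp only [Nat.cast_zero, pow_zero, mul_one, Nat.factorial_zero, Nat.cast_one, div_one] at h0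
  rw [setIntegral_univ, setIntegral_univ] at hd
  have hcompl : MeasurableSet[history S W s] {ω | pointCount S 0 s ω = 0}ᶜ :=
    (le_sup_left (b := ⨆ (r : ℝ≥0) (_ : r ≤ s), MeasurableSpace.comap (W r) inferInstance) _
      (measurableSet_count_eq_countsBefore le_rfl 0)).compl
  rw [hW.measureReal_inter_count le_rfl 0 hcompl, h0, hd, abs_mul, Real.abs_exp]
  have hmc := (hS.measurableSet_count_eq 0 s 0).compl
  have hi := fun r => integrable_comp_of_mem (P := P) (hW.measurable r) (hW.ae_mem r) f
  have hz : ∫ ω in {ω | pointCount S 0 s ω = 0}, f (W s ω) ∂P =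
      ∫ ω in {ω | pointCount S 0 s ω = 0}, f (W 0 ω) ∂P := by
    refine setIntegral_congr_ae (hS.measurableSet_count_eq 0 s 0) ?_
    filter_upwards [hW.eq_of_no_event] with ω hω h
    rw [hω 0 s zero_le h]
  have e1 := integral_add_compl (hS.measurableSet_count_eq 0 s 0) (hi s)
  have e2 := integral_add_compl (hS.measurableSet_count_eq 0 s 0) (hi 0)
  have hbs := abs_setIntegral_comp_le (hW.ae_mem s) hC {ω | pointCount S 0 s ω = 0}ᶜ
  have hb0 := abs_setIntegral_comp_le (hW.ae_mem 0) hC {ω | pointCount S 0 s ω = 0}ᶜ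
  have hW_s : |∫ ω, f (W s ω) ∂P| ≤ 2 * C * P.real {ω | pointCount S 0 s ω = 0}ᶜ := by
    have : ∫ ω, f (W s ω) ∂P = ∫ ω in {ω | pointCount S 0 s ω = 0}ᶜ, f (W s ω) ∂P -
        ∫ ω in {ω | pointCount S 0 s ω = 0}ᶜ, f (W 0 ω) ∂P := by linarith
    rw [this]
    exact (abs_sub _ _).trans (by linarith)
  have hm := rate_integral_nonneg hrate (NNReal.coe_pos.2 hs) (NNReal.coe_le_coe.2 hst)
  calc _ ≤ Real.exp (-∫ r in (s : ℝ)..t, rate r) *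
        (2 * C * P.real {ω | pointCount S 0 s ω = 0}ᶜ) := by
        refine mul_le_mul (Real.exp_le_exp.2 ?_) hW_s (abs_nonneg _) (Real.exp_pos _).le
        nlinarith
    _ = _ := by ring

/-- An eigenfunction of the switching kernel with initial mean zero has mean zero at all times. -/
theorem integral_eq_zero (hW : IsSwitchingVelocity P E init switch S W)
    (hS : IsPoissonProcess P rate S) (hrate : ∀ t, 0 < t → 0 ≤ rate t)
    (hcont : ContinuousOn rate (Set.Ioi 0)) {t : ℝ≥0} (ht : 0 < t) {f : ℝ → ℝ}
    {κ : ℝ} (hf : ∀ v ∈ E, ∑ w ∈ E, (switch v {w}).toReal * f w = κ * f v)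
    (hκ : -1 ≤ κ) (hκ' : κ ≤ 0) (hinit : ∫ ω, f (W 0 ω) ∂P = 0) :
    ∫ ω, f (W t ω) ∂P = 0 := by
  let q : ℕ → ℝ≥0 := fun n => t / (n + 1)
  have hq : ∀ n, 0 < q n := fun n => by positivity
  have hqt : ∀ n, q n ≤ t := fun n => div_le_self zero_le (by simp)
  have hanti : Antitone q := fun m n hmn => by
    dsimp only [q]
    gcongr
  let B : ℕ → Set Ω := fun n =>
    {ω | pointCount S 0 (q n) ω = 0}ᶜ ∩ {ω | pointCount S (q n) t ω = 0}
  have hB : Antitone B := by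
    intro m n hmn ω hω
    refine ⟨fun h => hω.1 ?_, ?_⟩
    · exact pointCount_eq_zero_iff.2 fun r hr hr0 =>
        (hanti hmn).trans_lt (pointCount_eq_zero_iff.1 h r hr hr0)
    · exact pointCount_eq_zero_iff.2 fun r hr hr0 =>
        pointCount_eq_zero_iff.1 hω.2 r hr ((hanti hmn).trans_lt hr0)
  -- No event in any `(q n, t]` means none in `(0, t]`, contradicting an event in `(0, q 0]`.
  -- Integrability of the rate at 0 plays no role.
  have hempty : ⋂ n, B n = ∅ := by
    refine Set.eq_empty_of_forall_notMem fun ω hω => ?_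
    rw [Set.mem_iInter] at hω
    refine (hω 0).1 (pointCount_eq_zero_iff.2 fun r hr hr0 => ?_)
    obtain ⟨n, hn⟩ := exists_nat_one_div_lt (div_pos hr0 ht)
    refine (hqt 0).trans_lt (pointCount_eq_zero_iff.1 (hω n).2 r hr ?_)
    rw [lt_div_iff₀ ht] at hn
    calc q n = 1 / (n + 1) * t := by simp only [q]; ring
      _ < r := hn
  have hlim : Tendsto (fun n => P.real (B n)) atTop (𝓝 0) := by
    have := tendsto_measure_iInter_atTop (μ := P) (s := B) (fun n =>
      ((hS.measurableSet_count_eq _ _ _).compl.inter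
        (hS.measurableSet_count_eq _ _ _)).nullMeasurableSet) hB ⟨0, measure_ne_top _ _⟩
    rw [hempty, measure_empty] at this
    simpa [measureReal_def, Function.comp_def] using
      (ENNReal.tendsto_toReal ENNReal.zero_ne_top).comp this
  have hC : ∀ v ∈ E, |f v| ≤ ∑ v ∈ E, |f v| := fun v hv =>
    Finset.single_le_sum (f := fun v => |f v|) (fun v _ => abs_nonneg _) hv
  refine abs_eq_zero.1 (le_antisymm ?_ (abs_nonneg _))
  refine ge_of_tendsto' (b := |∫ ω, f (W t ω) ∂P|)
    (f := fun n => 2 * (∑ v ∈ E, |f v|) * P.real (B n)) (x := atTop) ?_ fun n =>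
    hW.abs_integral_le hS hrate hcont (hq n) (hqt n) hf hκ hκ' hC hinit
  simpa using hlim.const_mul (2 * ∑ v ∈ E, |f v|)

end IsSwitchingVelocity

end

/-! ### Three-state motions: decay laws determine the law -/

section

variable {Ω : Type*} [mΩ : MeasurableSpace Ω] {P : Measure Ω}

/-- The hypothesis on set integrals says that `e * Z'` is the conditional expectation of `Z` given
`m`; the bounded `m`-measurable factor `G` can be pulled out. -/
theorem integral_mul_eq_of_setIntegral_eq [IsProbabilityMeasure P] {m : MeasurableSpace Ω}
    (hm : m ≤ mΩ) {G Z Z' : Ω → ℝ}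
    (hG : Measurable[m] G) {K : ℝ} (hK : ∀ᵐ ω ∂P, |G ω| ≤ K) (hZ : Integrable Z P)
    (hZ' : Integrable Z' P) (hZm : Measurable[m] Z') (e : ℝ)
    (h : ∀ A, MeasurableSet[m] A → ∫ ω in A, Z ω ∂P = e * ∫ ω in A, Z' ω ∂P) :
    ∫ ω, G ω * Z ω ∂P = e * ∫ ω, G ω * Z' ω ∂P := by
  have h1 : (fun ω => e * Z' ω) =ᵐ[P] P[Z | m] := by
    refine ae_eq_condExp_of_forall_setIntegral_eq hm hZ
      (fun A _ _ => (hZ'.const_mul e).integrableOn) (fun A hA _ => ?_)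
      (hZm.const_mul e).stronglyMeasurable.aestronglyMeasurable
    rw [integral_const_mul, h A hA]
  have h2 : P[G * Z | m] =ᵐ[P] G * P[Z | m] :=
    condExp_mul_of_stronglyMeasurable_left hG.stronglyMeasurable
      (hZ.bdd_mul (c := K) (hG.mono hm le_rfl).aestronglyMeasurable hK) hZ
  calc ∫ ω, G ω * Z ω ∂P = ∫ ω, (P[G * Z | m]) ω ∂P := (integral_condExp hm).symm
    _ = ∫ ω, e * (G ω * Z' ω) ∂P := by
      refine integral_congr_ae ?_
      filter_upwards [h1, h2] with ω h3 h4
      rw [h4, Pi.mul_apply, ← h3]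
      ring
    _ = _ := integral_const_mul _ _

/-- A process with values in `{c, 0, -c}`, adapted to `m`, such that the functions `v` and
`v ^ 2 - c ^ 2 / 2` of its value have mean zero and decay exponentially with the mean of the
number of events. -/
structure IsThreeStateMotion (P : Measure Ω) (c : ℝ) (rate : ℝ → ℝ)
    (m : Set.Ioi (0 : ℝ≥0) → MeasurableSpace Ω) (Y : Set.Ioi (0 : ℝ≥0) → Ω → ℝ) : Prop where
  le : ∀ s, m s ≤ mΩ
  measurable_of_le : ∀ r s, r ≤ s → Measurable[m s] (Y r)
  mem_states : ∀ t, ∀ᵐ ω ∂P, Y t ω ∈ ({c, 0, -c} : Finset ℝ)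
  integral_eq_zero : ∀ t, ∫ ω, Y t ω ∂P = 0
  integral_sq_eq_zero : ∀ t, ∫ ω, (Y t ω ^ 2 - c ^ 2 / 2) ∂P = 0
  setIntegral_eq : ∀ s t, s ≤ t → ∀ A, MeasurableSet[m s] A →
    ∫ ω in A, Y t ω ∂P =
      Real.exp (-∫ r in ((s : ℝ≥0) : ℝ)..(t : ℝ≥0), rate r) * ∫ ω in A, Y s ω ∂P
  setIntegral_sq_eq : ∀ s t, s ≤ t → ∀ A, MeasurableSet[m s] A →
    ∫ ω in A, (Y t ω ^ 2 - c ^ 2 / 2) ∂P =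
      Real.exp (-(2 * ∫ r in ((s : ℝ≥0) : ℝ)..(t : ℝ≥0), rate r)) *
        ∫ ω in A, (Y s ω ^ 2 - c ^ 2 / 2) ∂P

theorem exists_quadratic_eq_on_three {c : ℝ} (hc : c ≠ 0) (f : ℝ → ℝ) :
    ∃ α β γ : ℝ, ∀ v ∈ ({c, 0, -c} : Finset ℝ), f v = α + β * v + γ * (v ^ 2 - c ^ 2 / 2) := by
  -- Quadratic interpolation at three points: β comes from the odd part, γ from the second
  -- difference, and α corrects `f 0` by `γ * c ^ 2 / 2`.
  refine ⟨f 0 + ((f c + f (-c)) / 2 - f 0) / 2, (f c - f (-c)) / (2 * c),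
    ((f c + f (-c)) / 2 - f 0) / c ^ 2, fun v hv => ?_⟩
  simp only [Finset.mem_insert, Finset.mem_singleton] at hv
  rcases hv with rfl | rfl | rfl <;> field_simp <;> ring

namespace IsThreeStateMotion

variable {c : ℝ} {rate : ℝ → ℝ} {m : Set.Ioi (0 : ℝ≥0) → MeasurableSpace Ω}
  {Y : Set.Ioi (0 : ℝ≥0) → Ω → ℝ}

theorem measurable (hY : IsThreeStateMotion P c rate m Y) (t : Set.Ioi (0 : ℝ≥0)) :
    Measurable (Y t) := (hY.measurable_of_le t t le_rfl).mono (hY.le t) le_rfl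

theorem exists_abs_prod_le (hY : IsThreeStateMotion P c rate m Y)
    (J : Finset (Set.Ioi (0 : ℝ≥0))) (f : Set.Ioi (0 : ℝ≥0) → ℝ → ℝ) :
    ∃ K, ∀ᵐ ω ∂P, |∏ i ∈ J, f i (Y i ω)| ≤ K := by
  refine ⟨∏ i ∈ J, ∑ v ∈ ({c, 0, -c} : Finset ℝ), |f i v|, ?_⟩
  have h : ∀ᵐ ω ∂P, ∀ i ∈ J, Y i ω ∈ ({c, 0, -c} : Finset ℝ) :=
    (Filter.eventually_all_finset J).2 fun i _ => hY.mem_states i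
  filter_upwards [h] with ω hω
  rw [Finset.abs_prod]
  refine Finset.prod_le_prod (fun _ _ => abs_nonneg _) fun i hi => ?_
  exact Finset.single_le_sum (f := fun v => |f i v|) (fun v _ => abs_nonneg _) (hω i hi)

theorem measurable_prod (hY : IsThreeStateMotion P c rate m Y)
    {J : Finset (Set.Ioi (0 : ℝ≥0))} {f : Set.Ioi (0 : ℝ≥0) → ℝ → ℝ}
    (hf : ∀ i, Measurable (f i)) {b : Set.Ioi (0 : ℝ≥0)} (hb : ∀ i ∈ J, i ≤ b) :
    Measurable[m b] fun ω => ∏ i ∈ J, f i (Y i ω) :=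
  Finset.measurable_fun_prod _ fun i hi => (hf i).comp (hY.measurable_of_le i b (hb i hi))

variable [IsProbabilityMeasure P]

theorem integrable_comp (hY : IsThreeStateMotion P c rate m Y) (f : ℝ → ℝ)
    (t : Set.Ioi (0 : ℝ≥0)) : Integrable (fun ω => f (Y t ω)) P :=
  integrable_comp_of_mem (hY.measurable t) (hY.mem_states t) f

theorem integral_comp (hY : IsThreeStateMotion P c rate m Y) {f : ℝ → ℝ} {α β γ : ℝ}
    (hf : ∀ v ∈ ({c, 0, -c} : Finset ℝ), f v = α + β * v + γ * (v ^ 2 - c ^ 2 / 2))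
    (t : Set.Ioi (0 : ℝ≥0)) : ∫ ω, f (Y t ω) ∂P = α := by
  have h1 := hY.integrable_comp (fun v => α + β * v) t
  have h2 := hY.integrable_comp (fun v => γ * (v ^ 2 - c ^ 2 / 2)) t
  have h3 := hY.integrable_comp (fun v => β * v) t
  rw [integral_congr_ae ((hY.mem_states t).mono fun ω hω => hf _ hω), integral_add h1 h2,
    integral_add (integrable_const α) h3, integral_const_mul, integral_const_mul,
    hY.integral_eq_zero, hY.integral_sq_eq_zero]
  simp

/-- A Markov step: conditioning on `m b` replaces the factor at the latest time `a` by a function of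
the state at `b`. -/
theorem integral_prod_mul_comp (hY : IsThreeStateMotion P c rate m Y)
    {J : Finset (Set.Ioi (0 : ℝ≥0))} {f : Set.Ioi (0 : ℝ≥0) → ℝ → ℝ}
    (hf : ∀ i, Measurable (f i)) {b a : Set.Ioi (0 : ℝ≥0)} (hb : ∀ i ∈ J, i ≤ b) (hba : b ≤ a)
    {g : ℝ → ℝ} {α β γ : ℝ}
    (hg : ∀ v ∈ ({c, 0, -c} : Finset ℝ), g v = α + β * v + γ * (v ^ 2 - c ^ 2 / 2)) :
    ∫ ω, (∏ i ∈ J, f i (Y i ω)) * g (Y a ω) ∂P =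
      α * ∫ ω, ∏ i ∈ J, f i (Y i ω) ∂P +
      β * (Real.exp (-∫ r in ((b : ℝ≥0) : ℝ)..(a : ℝ≥0), rate r) *
        ∫ ω, (∏ i ∈ J, f i (Y i ω)) * Y b ω ∂P) +
      γ * (Real.exp (-(2 * ∫ r in ((b : ℝ≥0) : ℝ)..(a : ℝ≥0), rate r)) *
        ∫ ω, (∏ i ∈ J, f i (Y i ω)) * (Y b ω ^ 2 - c ^ 2 / 2) ∂P) := by
  obtain ⟨K, hK⟩ := hY.exists_abs_prod_le J f
  have hF := hY.measurable_prod hf hb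
  have hFm := (hF.mono (hY.le b) le_rfl).aestronglyMeasurable (μ := P)
  have hi1 := fun t => hY.integrable_comp (fun v => v) t
  have hi2 := fun t => hY.integrable_comp (fun v => v ^ 2 - c ^ 2 / 2) t
  have hYb := hY.measurable_of_le b b le_rfl
  rw [← integral_mul_eq_of_setIntegral_eq (hY.le b) hF hK (hi1 a) (hi1 b) hYb _
      (hY.setIntegral_eq b a hba),
    ← integral_mul_eq_of_setIntegral_eq (hY.le b) hF hK (hi2 a) (hi2 b)
      ((hYb.pow_const 2).sub_const _) _ (hY.setIntegral_sq_eq b a hba)]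
  have hF0 : Integrable (fun ω => ∏ i ∈ J, f i (Y i ω)) P := .of_bound hFm K hK
  have hF1 := ((hi1 a).bdd_mul hFm hK).const_mul β
  have hF2 := ((hi2 a).bdd_mul hFm hK).const_mul γ
  have hF01 : Integrable (fun ω => α * (∏ i ∈ J, f i (Y i ω)) +
      β * ((∏ i ∈ J, f i (Y i ω)) * Y a ω)) P := (hF0.const_mul α).add hF1
  rw [← integral_const_mul, ← integral_const_mul, ← integral_const_mul,
    ← integral_add (hF0.const_mul α) hF1, ← integral_add hF01 hF2]
  refine integral_congr_ae ?_
  filter_upwards [hY.mem_states a] with ω hω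
  rw [hg _ hω]
  ring

variable {Ω' : Type*} [mΩ' : MeasurableSpace Ω'] {P' : Measure Ω'} [IsProbabilityMeasure P']
  {m' : Set.Ioi (0 : ℝ≥0) → MeasurableSpace Ω'} {Y' : Set.Ioi (0 : ℝ≥0) → Ω' → ℝ}

/-- Induction on the largest time: its factor is moved to the preceding time `b` and absorbed into
the factor there. This changes the test functions, so the induction hypothesis must hold for all
`f`. -/
theorem integral_prod_eq (hc : c ≠ 0) (hY : IsThreeStateMotion P c rate m Y)
    (hY' : IsThreeStateMotion P' c rate m' Y') (J : Finset (Set.Ioi (0 : ℝ≥0))) :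
    ∀ f : Set.Ioi (0 : ℝ≥0) → ℝ → ℝ, (∀ i, Measurable (f i)) →
      ∫ ω, ∏ i ∈ J, f i (Y i ω) ∂P = ∫ ω, ∏ i ∈ J, f i (Y' i ω) ∂P' := by
  induction J using Finset.induction_on_max with
  | empty => simp
  | insert a J hJ ih =>
    intro f hf
    have haJ : a ∉ J := fun h => lt_irrefl a (hJ a h)
    obtain ⟨α, β, γ, hg⟩ := exists_quadratic_eq_on_three hc (f a)
    simp_rw [Finset.prod_insert haJ, mul_comm (f a _)]
    rcases J.eq_empty_or_nonempty with rfl | hne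
    · simp only [Finset.prod_empty, one_mul]
      rw [hY.integral_comp hg, hY'.integral_comp hg]
    · have hb : ∀ i ∈ J, i ≤ J.max' hne := fun i hi => J.le_max' i hi
      have hbJ := J.max'_mem hne
      have hba := (hJ _ hbJ).le
      generalize J.max' hne = b at hb hbJ hba
      have key : ∀ g : ℝ → ℝ, Measurable g →
          ∫ ω, (∏ i ∈ J, f i (Y i ω)) * g (Y b ω) ∂P =
            ∫ ω, (∏ i ∈ J, f i (Y' i ω)) * g (Y' b ω) ∂P' := by
        intro g hg
        have h := ih (fun i v => f i v * if i = b then g v else 1) fun i => by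
          refine (hf i).mul ?_
          split_ifs
          · exact hg
          · exact measurable_const
        simpa only [Finset.prod_mul_distrib, Finset.prod_ite_eq', if_pos hbJ] using h
      rw [hY.integral_prod_mul_comp hf hb hba hg, hY'.integral_prod_mul_comp hf hb hba hg, ih f hf,
        key (fun v => v) measurable_id,
        key (fun v => v ^ 2 - c ^ 2 / 2) ((measurable_id.pow_const 2).sub_const _)]

/-- The law of a three-state motion is determined by its velocity and its rate function. -/
theorem identDistrib (hc : c ≠ 0) (hY : IsThreeStateMotion P c rate m Y)
    (hY' : IsThreeStateMotion P' c rate m' Y') :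
    IdentDistrib (fun ω t => Y t ω) (fun ω t => Y' t ω) P P' := by
  have hm : Measurable fun ω t => Y t ω := measurable_pi_lambda _ hY.measurable
  have hm' : Measurable fun ω t => Y' t ω := measurable_pi_lambda _ hY'.measurable
  refine ⟨hm.aemeasurable, hm'.aemeasurable, ?_⟩
  have hpos : ∀ I : Finset (Set.Ioi (0 : ℝ≥0)),
      P.map (fun ω => I.restrict (Y · ω)) = P'.map (fun ω => I.restrict (Y' · ω)) := by
    intro I
    have hmI : Measurable fun ω => I.restrict (Y · ω) := (Finset.measurable_restrict I).comp hm
    have hmI' : Measurable fun ω => I.restrict (Y' · ω) := (Finset.measurable_restrict I).comp hm'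
    have := Measure.isProbabilityMeasure_map (μ := P) hmI.aemeasurable
    have := Measure.isProbabilityMeasure_map (μ := P') hmI'.aemeasurable
    refine ext_of_generate_finite _ generateFrom_pi.symm isPiSystem_pi ?_ (by simp)
    rintro _ ⟨B, hB, rfl⟩
    have hBm : ∀ i, MeasurableSet (B i) := fun i => hB i (Set.mem_univ i)
    have hBpi := MeasurableSet.univ_pi hBm
    classical
    -- The product of these functions is the indicator of the box `B`; boxes form a generating
    -- π-system.
    let f : Set.Ioi (0 : ℝ≥0) → ℝ → ℝ := fun i v =>
      if h : i ∈ I then (if v ∈ B ⟨i, h⟩ then 1 else 0) else 1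
    have hf : ∀ i, Measurable (f i) := by
      intro i
      by_cases h : i ∈ I
      · simp only [f, dif_pos h]
        exact Measurable.ite (hBm _) measurable_const measurable_const
      · simp only [f, dif_neg h]
        exact measurable_const
    have hprod : ∀ y : Set.Ioi (0 : ℝ≥0) → ℝ,
        ∏ i ∈ I, f i (y i) = (Set.univ.pi B).indicator (fun _ => (1 : ℝ)) (I.restrict y) := by
      intro y
      rw [← Finset.prod_coe_sort]
      have : ∀ i : I, f i (y i) = if y i ∈ B i then 1 else 0 := fun i => by
        simp only [f, dif_pos i.2]
      simp_rw [this, Finset.prod_boole, Set.indicator_apply, Set.mem_univ_pi]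
      simp
    have h := integral_prod_eq hc hY hY' I f hf
    simp_rw [hprod] at h
    rw [← integral_map hmI.aemeasurable
        ((measurable_const.indicator hBpi).aestronglyMeasurable),
      ← integral_map hmI'.aemeasurable
        ((measurable_const.indicator hBpi).aestronglyMeasurable),
      integral_indicator_const _ hBpi, integral_indicator_const _ hBpi, smul_eq_mul, smul_eq_mul,
      mul_one, mul_one] at h
    exact (measureReal_eq_measureReal_iff (measure_ne_top _ _) (measure_ne_top _ _)).1 h
  have h1 := isProjectiveLimit_map (P := P) hm.aemeasurable
  have h2 := isProjectiveLimit_map (P := P') hm'.aemeasurable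
  simp_rw [← hpos] at h2
  have : ∀ I : Finset (Set.Ioi (0 : ℝ≥0)),
      IsFiniteMeasure (P.map (fun ω => I.restrict (Y · ω))) := fun I => inferInstance
  exact h1.unique h2

end IsThreeStateMotion

end

/-! ### Two-state motions, their sums, and the given velocities -/

section

variable {Ω : Type*}

/-- The σ-algebra generated by a process up to time `s`. -/
@[reducible] def pastOf (Y : Set.Ioi (0 : ℝ≥0) → Ω → ℝ) (s : Set.Ioi (0 : ℝ≥0)) :
    MeasurableSpace Ω :=
  ⨆ (r : Set.Ioi (0 : ℝ≥0)) (_ : r ≤ s), MeasurableSpace.comap (Y r) inferInstance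

theorem measurable_pastOf (Y : Set.Ioi (0 : ℝ≥0) → Ω → ℝ) {r s : Set.Ioi (0 : ℝ≥0)} (h : r ≤ s) :
    Measurable[pastOf Y s] (Y r) :=
  Measurable.of_comap_le (le_iSup₂_of_le r h le_rfl)

theorem pastOf_le (Y : Set.Ioi (0 : ℝ≥0) → Ω → ℝ) (s : Set.Ioi (0 : ℝ≥0)) {m : MeasurableSpace Ω}
    (h : ∀ r, r ≤ s → Measurable[m] (Y r)) : pastOf Y s ≤ m :=
  iSup₂_le fun r hr => (h r hr).comap_le

variable [mΩ : MeasurableSpace Ω] {P : Measure Ω}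

/-- A π-λ argument: intersections `A ∩ B` form a π-system generating the join. It lets the decay
laws of a sum be checked on rectangles, where independence factorizes the integrals. -/
theorem setIntegral_eq_zero_of_sup {m₁ m₂ : MeasurableSpace Ω} (h₁ : m₁ ≤ mΩ) (h₂ : m₂ ≤ mΩ)
    {D : Ω → ℝ} (hD : Integrable D P)
    (h : ∀ A B, MeasurableSet[m₁] A → MeasurableSet[m₂] B → ∫ ω in A ∩ B, D ω ∂P = 0) (A : Set Ω)
    (hA : MeasurableSet[m₁ ⊔ m₂] A) : ∫ ω in A, D ω ∂P = 0 := by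
  have hle : m₁ ⊔ m₂ ≤ mΩ := sup_le h₁ h₂
  have huniv : ∫ ω, D ω ∂P = 0 := by
    simpa using h Set.univ Set.univ MeasurableSet.univ MeasurableSet.univ
  have hgen : m₁ ⊔ m₂ = MeasurableSpace.generateFrom
      (Set.image2 (· ∩ ·) {A | MeasurableSet[m₁] A} {B | MeasurableSet[m₂] B}) := by
    refine le_antisymm (sup_le (fun A hA => ?_) fun B hB => ?_)
      (MeasurableSpace.generateFrom_le ?_)
    · exact MeasurableSpace.measurableSet_generateFrom
        ⟨A, hA, Set.univ, MeasurableSet.univ, Set.inter_univ A⟩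
    · exact MeasurableSpace.measurableSet_generateFrom
        ⟨Set.univ, MeasurableSet.univ, B, hB, Set.univ_inter B⟩
    · rintro _ ⟨A, hA, B, hB, rfl⟩
      exact MeasurableSet.inter (le_sup_left (a := m₁) (b := m₂) A hA)
        (le_sup_right (a := m₁) (b := m₂) B hB)
  have hpi : IsPiSystem
      (Set.image2 (· ∩ ·) {A | MeasurableSet[m₁] A} {B | MeasurableSet[m₂] B}) := by
    rintro _ ⟨A, hA, B, hB, rfl⟩ _ ⟨A', hA', B', hB', rfl⟩ _
    exact ⟨A ∩ A', MeasurableSet.inter hA hA', B ∩ B', MeasurableSet.inter hB hB',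
      Set.inter_inter_inter_comm A A' B B'⟩
  induction A, hA using MeasurableSpace.induction_on_inter hgen hpi with
  | empty => simp
  | basic _ hA =>
    obtain ⟨A, hA, B, hB, rfl⟩ := hA
    exact h A B hA hB
  | compl A hA ih =>
    have := integral_add_compl (hle A hA) hD
    linarith
  | iUnion A hdisj hA ih =>
    rw [integral_iUnion (fun i => hle _ (hA i)) hdisj hD.integrableOn]
    simp [ih]

theorem setIntegral_inter_mul_of_indep {m₁ m₂ : MeasurableSpace Ω} (h₁ : m₁ ≤ mΩ) (h₂ : m₂ ≤ mΩ)
    (h : Indep m₁ m₂ P) {A B : Set Ω} (hA : MeasurableSet[m₁] A) (hB : MeasurableSet[m₂] B)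
    {f g : Ω → ℝ} (hf : Measurable[m₁] f) (hg : Measurable[m₂] g) :
    ∫ ω in A ∩ B, f ω * g ω ∂P = (∫ ω in A, f ω ∂P) * ∫ ω in B, g ω ∂P := by
  have hf' : Measurable[m₁] (A.indicator f) := hf.indicator hA
  have hg' : Measurable[m₂] (B.indicator g) := hg.indicator hB
  have hind : IndepFun (A.indicator f) (B.indicator g) P :=
    (IndepFun_iff_Indep _ _ _).2
      (indep_of_indep_of_le_right (indep_of_indep_of_le_left h hf'.comap_le) hg'.comap_le)
  rw [← integral_indicator (h₁ A hA), ← integral_indicator (h₂ B hB),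
    ← integral_indicator ((h₁ A hA).inter (h₂ B hB)),
    ← hind.integral_fun_mul_eq_mul_integral (hf'.mono h₁ le_rfl).aestronglyMeasurable
      (hg'.mono h₂ le_rfl).aestronglyMeasurable]
  simp_rw [Set.inter_indicator_mul]

variable [IsProbabilityMeasure P]

/-- A symmetric process with values `± a`, whose mean decays exponentially given its past. -/
structure IsTwoStateMotion (P : Measure Ω) (a : ℝ) (rate : ℝ → ℝ)
    (Y : Set.Ioi (0 : ℝ≥0) → Ω → ℝ) : Prop where
  measurable : ∀ t, Measurable (Y t)
  mem_states : ∀ t, ∀ᵐ ω ∂P, Y t ω ∈ ({a, -a} : Finset ℝ)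
  integral_eq_zero : ∀ t, ∫ ω, Y t ω ∂P = 0
  setIntegral_eq : ∀ s t, s ≤ t → ∀ A, MeasurableSet[pastOf Y s] A →
    ∫ ω in A, Y t ω ∂P =
      Real.exp (-∫ r in ((s : ℝ≥0) : ℝ)..(t : ℝ≥0), rate r) * ∫ ω in A, Y s ω ∂P

/-- The sum of two independent two-state motions is a three-state motion. -/
theorem IsTwoStateMotion.add {a c : ℝ} (hac : a = c / 2) {rate : ℝ → ℝ}
    {Y Z : Set.Ioi (0 : ℝ≥0) → Ω → ℝ}
    (hY : IsTwoStateMotion P a rate Y) (hZ : IsTwoStateMotion P a rate Z)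
    (h : IndepFun (fun ω t => Y t ω) (fun ω t => Z t ω) P) :
    IsThreeStateMotion P c rate (fun s => pastOf Y s ⊔ pastOf Z s) fun t ω => Y t ω + Z t ω := by
  have hleY := fun s => pastOf_le Y s fun r _ => hY.measurable r
  have hleZ := fun s => pastOf_le Z s fun r _ => hZ.measurable r
  have hiY := fun t => integrable_comp_of_mem (hY.measurable t) (hY.mem_states t) fun v => v
  have hiZ := fun t => integrable_comp_of_mem (hZ.measurable t) (hZ.mem_states t) fun v => v
  have hind : ∀ t, Indep (pastOf Y t) (pastOf Z t) P := fun t => by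
    refine indep_of_indep_of_le_right (indep_of_indep_of_le_left
      ((IndepFun_iff_Indep _ _ _).1 h) ?_) ?_
    · exact pastOf_le Y t fun r _ =>
        (measurable_pi_apply r).comp (comap_measurable fun ω t => Y t ω)
    · exact pastOf_le Z t fun r _ =>
        (measurable_pi_apply r).comp (comap_measurable fun ω t => Z t ω)
  have hmono : ∀ (X : Set.Ioi (0 : ℝ≥0) → Ω → ℝ) {s t}, s ≤ t → pastOf X s ≤ pastOf X t :=
    fun X s t hst => pastOf_le X s fun r hr => measurable_pastOf X (hr.trans hst)
  have hmul : ∀ {s t : Set.Ioi (0 : ℝ≥0)}, s ≤ t → ∀ {A B}, MeasurableSet[pastOf Y s] A →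
      MeasurableSet[pastOf Z s] B → ∀ {f g : Ω → ℝ}, Measurable[pastOf Y t] f →
      Measurable[pastOf Z t] g →
      ∫ ω in A ∩ B, f ω * g ω ∂P = (∫ ω in A, f ω ∂P) * ∫ ω in B, g ω ∂P :=
    fun {s t} hst {A B} hA hB f g hf hg => setIntegral_inter_mul_of_indep (hleY t) (hleZ t)
      (hind t) (hmono Y hst A hA) (hmono Z hst B hB) hf hg
  have hiS : ∀ t, Integrable (fun ω => Y t ω + Z t ω) P := fun t => (hiY t).add (hiZ t)
  have hiYZ : ∀ t, Integrable (fun ω => Y t ω * Z t ω) P := fun t => by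
    refine (hiZ t).bdd_mul (c := |a|) (hY.measurable t).aestronglyMeasurable ?_
    filter_upwards [hY.mem_states t] with ω hω
    simp only [Finset.mem_insert, Finset.mem_singleton] at hω
    rcases hω with h | h <;> simp [h]
  -- Both squares equal `c ^ 2 / 4`, so only the cross term survives.
  have hsq : ∀ t, (fun ω => (Y t ω + Z t ω) ^ 2 - c ^ 2 / 2) =ᵐ[P]
      fun ω => 2 * (Y t ω * Z t ω) := fun t => by
    filter_upwards [hY.mem_states t, hZ.mem_states t] with ω h1 h2
    simp only [Finset.mem_insert, Finset.mem_singleton] at h1 h2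
    rcases h1 with h1 | h1 <;> rcases h2 with h2 | h2 <;> rw [h1, h2, hac] <;> ring
  refine ⟨fun s => sup_le (hleY s) (hleZ s), fun r s hrs => ?_, fun t => ?_, fun t => ?_,
    fun t => ?_, fun s t hst A hA => ?_, fun s t hst A hA => ?_⟩
  · exact Measurable.add ((measurable_pastOf Y hrs).mono le_sup_left le_rfl)
      ((measurable_pastOf Z hrs).mono le_sup_right le_rfl)
  · filter_upwards [hY.mem_states t, hZ.mem_states t] with ω h1 h2
    simp only [Finset.mem_insert, Finset.mem_singleton] at h1 h2 ⊢
    rcases h1 with h1 | h1 <;> rcases h2 with h2 | h2 <;> rw [h1, h2, hac]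
    · left; ring
    · right; left; ring
    · right; left; ring
    · right; right; ring
  · rw [integral_add (hiY t) (hiZ t), hY.integral_eq_zero, hZ.integral_eq_zero, add_zero]
  · rw [integral_congr_ae (hsq t), integral_const_mul]
    have := hmul (le_refl t) MeasurableSet.univ MeasurableSet.univ (measurable_pastOf Y le_rfl)
      (measurable_pastOf Z le_rfl)
    rw [Set.univ_inter, setIntegral_univ, setIntegral_univ, setIntegral_univ,
      hY.integral_eq_zero] at this
    rw [this]
    simp
  · set e := Real.exp (-∫ r in ((s : ℝ≥0) : ℝ)..(t : ℝ≥0), rate r) with he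
    have hD : Integrable (fun ω => (Y t ω + Z t ω) - e * (Y s ω + Z s ω)) P :=
      (hiS t).sub ((hiS s).const_mul e)
    have := setIntegral_eq_zero_of_sup (hleY s) (hleZ s) hD (fun A B hA hB => ?_) A hA
    · rw [integral_sub (hiS t).integrableOn ((hiS s).const_mul e).integrableOn,
        integral_const_mul] at this
      exact sub_eq_zero.1 this
    · rw [integral_sub (hiS t).integrableOn ((hiS s).const_mul e).integrableOn,
        integral_const_mul,
        integral_add (hiY t).integrableOn (hiZ t).integrableOn,
        integral_add (hiY s).integrableOn (hiZ s).integrableOn]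
      have hY1 : ∀ u, s ≤ u → ∫ ω in A ∩ B, Y u ω ∂P = (∫ ω in A, Y u ω ∂P) * P.real B :=
        fun u hu => by
          simpa using hmul hu hA hB (measurable_pastOf Y le_rfl) (measurable_const (a := (1 : ℝ)))
      have hZ1 : ∀ u, s ≤ u → ∫ ω in A ∩ B, Z u ω ∂P = P.real A * ∫ ω in B, Z u ω ∂P :=
        fun u hu => by
          simpa using hmul hu hA hB (measurable_const (a := (1 : ℝ))) (measurable_pastOf Z le_rfl)
      rw [hY1 t hst, hY1 s le_rfl, hZ1 t hst, hZ1 s le_rfl, hY.setIntegral_eq s t hst A hA,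
        hZ.setIntegral_eq s t hst B hB, ← he]
      ring
  · rw [setIntegral_congr_ae (sup_le (hleY s) (hleZ s) A hA) ((hsq t).mono fun ω h _ => h),
      setIntegral_congr_ae (sup_le (hleY s) (hleZ s) A hA) ((hsq s).mono fun ω h _ => h),
      integral_const_mul, integral_const_mul]
    set e := Real.exp (-∫ r in ((s : ℝ≥0) : ℝ)..(t : ℝ≥0), rate r) with he
    have hee : Real.exp (-(2 * ∫ r in ((s : ℝ≥0) : ℝ)..(t : ℝ≥0), rate r)) = e * e := by
      rw [he, ← Real.exp_add]
      congr 1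
      ring
    have hD : Integrable (fun ω => Y t ω * Z t ω - e * e * (Y s ω * Z s ω)) P :=
      (hiYZ t).sub ((hiYZ s).const_mul _)
    have := setIntegral_eq_zero_of_sup (hleY s) (hleZ s) hD (fun A B hA hB => ?_) A hA
    · rw [integral_sub (hiYZ t).integrableOn ((hiYZ s).const_mul _).integrableOn,
        integral_const_mul] at this
      rw [hee, sub_eq_zero.1 this]
      ring
    · rw [integral_sub (hiYZ t).integrableOn ((hiYZ s).const_mul _).integrableOn,
        integral_const_mul,
        hmul hst hA hB (measurable_pastOf Y le_rfl) (measurable_pastOf Z le_rfl),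
        hmul le_rfl hA hB (measurable_pastOf Y le_rfl) (measurable_pastOf Z le_rfl),
        hY.setIntegral_eq s t hst A hA, hZ.setIntegral_eq s t hst B hB, ← he]
      ring

variable {S : Ω → Set ℝ≥0} {W : ℝ≥0 → Ω → ℝ} {rate : ℝ → ℝ}

/-- The velocity of a telegraph process is a two-state motion. -/
theorem IsSwitchingVelocity.isTwoStateMotion {a : ℝ} (ha : 0 < a)
    (hrate : ∀ t, 0 < t → 0 ≤ rate t) (hcont : ContinuousOn rate (Set.Ioi 0))
    (hS : IsPoissonProcess P (fun t => rate t / 2) S)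
    (hW : IsSwitchingVelocity P ({a, -a} : Finset ℝ)
      ((2⁻¹ : ℝ≥0∞) • Measure.dirac a + (2⁻¹ : ℝ≥0∞) • Measure.dirac (-a))
      (fun v => Measure.dirac (-v)) S W) :
    IsTwoStateMotion P a rate fun t => W t := by
  have hne : a ≠ -a := by linarith
  have hf : ∀ v ∈ ({a, -a} : Finset ℝ),
      ∑ w ∈ ({a, -a} : Finset ℝ), ((Measure.dirac (-v) : Measure ℝ) {w}).toReal * w = -1 * v := by
    intro v hv
    rw [Finset.sum_pair hne]
    simp only [Finset.mem_insert, Finset.mem_singleton] at hv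
    rcases hv with rfl | rfl <;> simp [hne, hne.symm]
  have hr : ∀ t : ℝ, 0 < t → 0 ≤ rate t / 2 := fun t ht => div_nonneg (hrate t ht) zero_le_two
  have hc : ContinuousOn (fun t => rate t / 2) (Set.Ioi 0) := hcont.div_const 2
  have hinit : ∫ ω, W 0 ω ∂P = 0 := by
    rw [hW.law_zero.integral_eq, integral_add_measure]
    · simp
    · exact (integrable_dirac (by simp)).smul_measure (by simp)
    · exact (integrable_dirac (by simp)).smul_measure (by simp)
  refine ⟨fun t => hW.measurable t, fun t => hW.ae_mem t, fun t => ?_, fun s t hst A hA => ?_⟩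
  · exact hW.integral_eq_zero hS hr hc t.2 (f := fun v => v) hf le_rfl (by norm_num) hinit
  · have h := hW.setIntegral_eq_exp_mul hS hr hc s.2 hst (f := fun v => v) hf le_rfl (by norm_num)
      (pastOf_le _ s (fun r hr => measurable_history hr) A hA)
    -- The factor `1 - κ = 2` cancels the halving of the rate.
    rw [h, intervalIntegral.integral_div]
    congr 2
    ring

/-- The velocity of a three-velocity process is a three-state motion. -/
theorem IsSwitchingVelocity.isThreeStateMotion {c : ℝ} (hc : 0 < c)
    (hrate : ∀ t, 0 < t → 0 ≤ rate t) (hcont : ContinuousOn rate (Set.Ioi 0))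
    (hS : IsPoissonProcess P rate S)
    (hW : IsSwitchingVelocity P ({c, 0, -c} : Finset ℝ)
      ((4⁻¹ : ℝ≥0∞) • Measure.dirac c + (2⁻¹ : ℝ≥0∞) • Measure.dirac 0
        + (4⁻¹ : ℝ≥0∞) • Measure.dirac (-c)) (threeVelocitySwitch c) S W) :
    IsThreeStateMotion P c rate (fun s => history S W s) fun t => W t := by
  have hne : c ≠ -c := by linarith
  have hsum : ∀ g : ℝ → ℝ, ∑ w ∈ ({c, 0, -c} : Finset ℝ), g w = g c + (g 0 + g (-c)) := by
    intro g
    rw [Finset.sum_insert (by simp [hc.ne', hne]), Finset.sum_pair (by linarith)]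
  -- From any state the mean velocity after one switch is 0: eigenvalue 0.
  have hf1 : ∀ v ∈ ({c, 0, -c} : Finset ℝ),
      ∑ w ∈ ({c, 0, -c} : Finset ℝ), (threeVelocitySwitch c v {w}).toReal * w = 0 * v := by
    intro v hv
    rw [hsum]
    simp only [Finset.mem_insert, Finset.mem_singleton] at hv
    rcases hv with rfl | rfl | rfl <;>
      simp [threeVelocitySwitch, hc.ne, hc.ne', hne, hne.symm]
  -- A switch exchanges moving and resting, where the function is `c ^ 2 / 2` and `-c ^ 2 / 2`:
  -- eigenvalue -1.
  have hf2 : ∀ v ∈ ({c, 0, -c} : Finset ℝ),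
      ∑ w ∈ ({c, 0, -c} : Finset ℝ), (threeVelocitySwitch c v {w}).toReal * (w ^ 2 - c ^ 2 / 2) =
        -1 * (v ^ 2 - c ^ 2 / 2) := by
    intro v hv
    rw [hsum]
    simp only [Finset.mem_insert, Finset.mem_singleton] at hv
    rcases hv with rfl | rfl | rfl <;>
      simp [threeVelocitySwitch, hc.ne, hc.ne', hne, hne.symm] <;> ring
  have hint : ∀ g : ℝ → ℝ, Measurable g → ∫ ω, g (W 0 ω) ∂P = g c / 4 + g 0 / 2 + g (-c) / 4 := by
    intro g hg
    have hi : ∀ x : ℝ, ∀ q : ℝ≥0∞, q ≠ ⊤ → Integrable g (q • Measure.dirac x) := fun x q hq =>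
      (integrable_dirac (by simp)).smul_measure hq
    have h := hW.law_zero.integral_comp hg.aestronglyMeasurable
    rw [integral_add_measure (integrable_add_measure.2 ⟨hi _ _ (by simp), hi _ _ (by simp)⟩)
      (hi _ _ (by simp)), integral_add_measure (hi _ _ (by simp)) (hi _ _ (by simp))] at h
    simp only [integral_smul_measure, integral_dirac, Function.comp_apply] at h
    rw [h]
    simp
    ring
  refine ⟨fun s => history_le hS hW.measurable s, fun r s hrs => measurable_history hrs,
    fun t => hW.ae_mem t, fun t => ?_, fun t => ?_, fun s t hst A hA => ?_,
    fun s t hst A hA => ?_⟩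
  · refine hW.integral_eq_zero hS hrate hcont t.2 (f := fun v => v) hf1 (by norm_num) le_rfl ?_
    rw [hint (fun v => v) measurable_id]
    ring
  · refine hW.integral_eq_zero hS hrate hcont t.2 (f := fun v => v ^ 2 - c ^ 2 / 2) hf2 le_rfl
      (by norm_num) ?_
    rw [hint (fun v => v ^ 2 - c ^ 2 / 2) ((measurable_id.pow_const 2).sub_const _)]
    ring
  · have h := hW.setIntegral_eq_exp_mul hS hrate hcont s.2 hst (f := fun v => v) hf1
      (by norm_num) le_rfl hA
    rw [h]
    congr 2
    ring
  · have h := hW.setIntegral_eq_exp_mul hS hrate hcont s.2 hst (f := fun v => v ^ 2 - c ^ 2 / 2)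
      hf2 le_rfl (by norm_num) hA
    rw [h]
    congr 2
    ring

end

/-! ### From velocities back to positions -/

theorem mainTheorem5 {Ω Ω' : Type*} [MeasurableSpace Ω] [MeasurableSpace Ω']
    (P : Measure Ω) [IsProbabilityMeasure P] (P' : Measure Ω') [IsProbabilityMeasure P']
    (c : ℝ) (hc : 0 < c) (rate : ℝ → ℝ)
    (hrate_smooth : ContDiffOn ℝ 1 rate (Set.Ioi 0)) (hrate_nonneg : ∀ t, 0 < t → 0 ≤ rate t)
    (U V : ℝ≥0 → Ω → ℝ)
    (hU : IsTelegraphProcess P (c / 2) (fun t => rate t / 2) U)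
    (hV : IsTelegraphProcess P (c / 2) (fun t => rate t / 2) V)
    (hUV : IndepFun (fun ω t => U t ω) (fun ω t => V t ω) P)
    (T : ℝ≥0 → Ω' → ℝ) (hT : IsThreeVelocityProcess P' c rate T) :
    IdentDistrib (fun ω t => U t ω + V t ω) (fun ω t => T t ω) P P' := by
  have hcont := hrate_smooth.continuousOn
  obtain ⟨S₁, W₁, hS₁, hW₁, hU⟩ := hU
  obtain ⟨S₂, W₂, hS₂, hW₂, hV⟩ := hV
  obtain ⟨S₃, W₃, hS₃, hW₃, hT⟩ := hT
  have h2 : ({c / 2, -(c / 2)} : Set ℝ) = (({c / 2, -(c / 2)} : Finset ℝ) : Set ℝ) := by simp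
  have h3 : ({c, 0, -c} : Set ℝ) = (({c, 0, -c} : Finset ℝ) : Set ℝ) := by simp
  rw [h2] at hW₁ hW₂
  rw [h3] at hW₃
  have hp₁ := hW₁.ae_isStepPath hS₁
  have hp₂ := hW₂.ae_isStepPath hS₂
  have hp₃ := hW₃.ae_isStepPath hS₃
  have hd₁ : (fun ω => rightDeriv fun t => U t ω) =ᵐ[P] fun ω s => W₁ s ω := by
    filter_upwards [hp₁, hU] with ω hp hx
    exact funext fun s => hp.rightDeriv_eq hx s
  have hd₂ : (fun ω => rightDeriv fun t => V t ω) =ᵐ[P] fun ω s => W₂ s ω := by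
    filter_upwards [hp₂, hV] with ω hp hx
    exact funext fun s => hp.rightDeriv_eq hx s
  -- Independence is assumed for the positions only; it passes to the velocities, which are almost
  -- surely measurable functions of them.
  have hind : IndepFun (fun ω (s : Set.Ioi (0 : ℝ≥0)) => W₁ s ω)
      (fun ω (s : Set.Ioi (0 : ℝ≥0)) => W₂ s ω) P :=
    (hUV.comp measurable_rightDeriv measurable_rightDeriv).congr hd₁ hd₂
  have hsum := (hW₁.isTwoStateMotion (half_pos hc) hrate_nonneg hcont hS₁).add rfl
    (hW₂.isTwoStateMotion (half_pos hc) hrate_nonneg hcont hS₂) hind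
  have hid := (hsum.identDistrib hc.ne'
    (hW₃.isThreeStateMotion hc hrate_nonneg hcont hS₃)).comp measurable_pathIntegral
  have hX : (fun ω => pathIntegral fun s => W₁ s ω + W₂ s ω) =ᵐ[P] fun ω t => U t ω + V t ω := by
    filter_upwards [hp₁, hp₂, hU, hV] with ω h1 h2 hx hy
    funext t
    rw [(h1.add h2).pathIntegral_eq t, hx, hy]
    exact intervalIntegral.integral_add (h1.intervalIntegrable le_rfl t.coe_nonneg)
      (h2.intervalIntegrable le_rfl t.coe_nonneg)
  have hX' : (fun ω => pathIntegral fun s => W₃ s ω) =ᵐ[P'] fun ω t => T t ω := by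
    filter_upwards [hp₃, hT] with ω h1 hx
    funext t
    rw [h1.pathIntegral_eq t, hx]
  have hm := hid.aemeasurable_fst
  have hm' := hid.aemeasurable_snd
  exact ((IdentDistrib.of_ae_eq hm hX).symm.trans hid).trans (IdentDistrib.of_ae_eq hm' hX')
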